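/- Let $n\ge 1$, let $\mathbb S^{d}(\mathbb C)=\{z\in\mathbb C^n: |z|=1\}$ with $d=2n-1$, let $\nu$ be its normalized surface measure, $\langle x,y\rangle=\sum_j x_j\overline{y_j}$, and let $\Delta$ be its (nonnegative) Laplace--Beltrami operator. For $k\ge 0$ let $\mathrm H_k$ be the space of smooth functions $f:\mathbb S^d(\mathbb C)\to\mathbb C$ with $\Delta f=k(k+d-1)f$. Fix $a\in\{0,1\}$ and put $\mathcal T_N=\mathrm{lin}\{\mathrm H_k: a\le k\le N\}$ (so that $a=0$ includes the constants and $a=1$ omits them). For a function $\Psi$ of one complex variable, the kernel $\kappa(x,y)=\Psi(\langle x,y\rangle)$ is called invariant, and $(\kappa * f)(x)=\int f(y)\,\Psi(\langle x,y\rangle)\,d\nu(y)$; we say that $\kappa$ lies in $\mathcal T_N$ if $\kappa(\cdot,e)\in\mathcal T_N$ for every $e\in\mathbb S^d(\mathbb C)$, and $\|\kappa\|_1\le C$ means that $\int|\kappa(x,e)|\,d\nu(x)\le C$ for every $e$. Define $\chi_0$ as the indicator function of $[0,1]$ and $\chi_s(t)=2d\int_t^{t+1/(2d)}\chi_{s-1}(u)\,du$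 for $1\le s\le d$. Then $\chi_d$ is $d-1$ times continuously differentiable, $\chi_d^{(d-1)}$ is Lipschitz continuous, $\chi_d\ge 0$ on $[0,\infty)$, $\chi_d=1$ on $[0,1/2]$, $\chi_d(t)=\frac{(2d)^d}{d!}(1-t)^d$ for $1-\frac1{2d}\le t\le 1$, and $\chi_d$ agrees with a polynomial of degree $d$ on each interval $[1-\frac{s}{2d},\,1-\frac{s-1}{2d}]$, $1\le s\le d$. Moreover, for every $k\ge0$ the space $\mathrm H_k$, with the scalar product of $L_2(\nu)$, has an invariant reproducing kernel $M_k$, and the kernels $$Q_{2N}=\sum_{k=a}^{2N}\chi_d\!\left(\frac{k}{2N}\right)M_k,\qquad N=1,2,\dots,$$ satisfy $Q_{2N}\in\mathcal T_{2N}$, $Q_{2N}*t_N=t_N$ for every $t_N\in\mathcal T_N$, and $\|Q_{2N}\|_1\le C$ for all $N\ge1$, with a constant $C$ that depends only on $n$. -/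

import Mathlib

open MeasureTheory
open scoped NNReal ContDiff InnerProductSpace

noncomputable section

namespace ComplexSphere

/-- The unit sphere of `ℂⁿ`, a real manifold of dimension `d = 2 * n - 1`. -/
abbrev CSphere (n : ℕ) : Type := Metric.sphere (0 : EuclideanSpace ℂ (Fin n)) 1

/-- The real dimension of the unit sphere of `ℂⁿ`. -/
def dim (n : ℕ) : ℕ := 2 * n - 1

/-- The normalized surface measure on the unit sphere of `ℂⁿ`. -/
def nu (n : ℕ) : Measure (CSphere n) :=
  let σ : Measure (CSphere n) := (volume : Measure (EuclideanSpace ℂ (Fin n))).toSphere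
  (σ Set.univ)⁻¹ • σ

/-- The Hermitian product `∑ j, w j * conj (z j)`, linear in the first argument. -/
def herm {n : ℕ} (w z : CSphere n) : ℂ :=
  inner ℂ (z : EuclideanSpace ℂ (Fin n)) (w : EuclideanSpace ℂ (Fin n))

/-- The extension of a function on the sphere to `ℂⁿ` that is constant on open rays from the
origin (with value `0` at the origin). -/
def radialExt {n : ℕ} (f : CSphere n → ℂ) (x : EuclideanSpace ℂ (Fin n)) : ℂ :=
  open Classical in
  if h : x = 0 then 0
  else f ⟨(‖x‖⁻¹ : ℝ) • x, by
    rw [mem_sphere_zero_iff_norm, norm_smul, norm_inv, norm_norm,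
      inv_mul_cancel₀ (norm_ne_zero_iff.2 h)]⟩

/-- Smoothness (in the real sense) of a function on the sphere. -/
def IsSmooth {n : ℕ} (f : CSphere n → ℂ) : Prop :=
  ContDiffOn ℝ ∞ (radialExt f) {0}ᶜ

/-- The (nonnegative) Laplace-Beltrami operator of the round metric: minus the Euclidean Laplacian
of `ℂⁿ = ℝ²ⁿ` applied to the extension that is constant along rays, restricted to the sphere. -/
def laplaceBeltrami {n : ℕ} (f : CSphere n → ℂ) (x : CSphere n) : ℂ :=
  -(Laplacian.laplacian (radialExt f) : EuclideanSpace ℂ (Fin n) → ℂ) x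

theorem radialExt_add {n : ℕ} (f g : CSphere n → ℂ) :
    radialExt (f + g) = radialExt f + radialExt g := by
  funext x
  by_cases h : x = 0 <;> simp [radialExt, h]

theorem radialExt_smul {n : ℕ} (c : ℂ) (f : CSphere n → ℂ) :
    radialExt (c • f) = c • radialExt f := by
  funext x
  by_cases h : x = 0 <;> simp [radialExt, h]

theorem radialExt_zero {n : ℕ} : radialExt (0 : CSphere n → ℂ) = fun _ => 0 := by
  funext x
  by_cases h : x = 0 <;> simp [radialExt, h]

theorem contDiffAt_of_isSmooth {n : ℕ} {f : CSphere n → ℂ} (hf : IsSmooth f) (x : CSphere n) :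
    ContDiffAt ℝ 2 (radialExt f) (x : EuclideanSpace ℂ (Fin n)) := by
  have hx : (x : EuclideanSpace ℂ (Fin n)) ≠ 0 := by
    intro h
    have := mem_sphere_zero_iff_norm.1 x.2
    rw [h, norm_zero] at this
    exact zero_ne_one this
  exact (ContDiffOn.contDiffAt hf (isOpen_compl_singleton.mem_nhds hx)).of_le
    (WithTop.coe_le_coe.2 le_top)

/-- The eigenvalue `θ_k = k (k + d - 1)` of the Laplace-Beltrami operator. -/
def theta (n k : ℕ) : ℝ := (k : ℝ) * ((k : ℝ) + (dim n : ℝ) - 1)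

/-- The eigenspace `H_k` of the Laplace-Beltrami operator for the eigenvalue `θ_k`. -/
def eigenspace (n k : ℕ) : Submodule ℂ (CSphere n → ℂ) where
  carrier := {f | IsSmooth f ∧ ∀ x, laplaceBeltrami f x = (theta n k : ℂ) * f x}
  zero_mem' := by
    refine ⟨?_, fun x => ?_⟩
    · unfold IsSmooth
      rw [radialExt_zero]
      exact contDiffOn_const
    · unfold laplaceBeltrami
      rw [radialExt_zero, InnerProductSpace.laplacian_const]
      simp
  add_mem' := by
    rintro f g ⟨hf, hf'⟩ ⟨hg, hg'⟩
    refine ⟨?_, fun x => ?_⟩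
    · unfold IsSmooth
      rw [radialExt_add]
      exact ContDiffOn.add hf hg
    · have h1 := hf' x
      have h2 := hg' x
      unfold laplaceBeltrami at h1 h2 ⊢
      rw [radialExt_add, (contDiffAt_of_isSmooth hf x).laplacian_add (contDiffAt_of_isSmooth hg x), neg_add, h1, h2,
        Pi.add_apply, mul_add]
  smul_mem' := by
    rintro c f ⟨hf, hf'⟩
    refine ⟨?_, fun x => ?_⟩
    · unfold IsSmooth
      rw [radialExt_smul]
      exact ContDiffOn.const_smul c hf
    · have h1 := hf' x
      unfold laplaceBeltrami at h1 ⊢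
      rw [radialExt_smul, InnerProductSpace.laplacian_smul c (contDiffAt_of_isSmooth hf x), ← smul_neg, h1,
        Pi.smul_apply, smul_eq_mul, smul_eq_mul]
      ring

/-- The space `lin {H_k : a ≤ k ≤ N}`. -/
def polySpace (n a N : ℕ) : Submodule ℂ (CSphere n → ℂ) :=
  ⨆ k ∈ Finset.Icc a N, eigenspace n k

/-- `K` is the reproducing kernel of the space `V` of functions on the sphere, with respect to the
scalar product of `L₂(ν)`. -/
def IsReproducingKernel {n : ℕ} (V : Submodule ℂ (CSphere n → ℂ))
    (K : CSphere n → CSphere n → ℂ) : Prop :=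
  (∀ y, (fun x => K x y) ∈ V) ∧
    ∀ f ∈ V, ∀ y, f y = ∫ x, f x * (starRingEnd ℂ) (K x y) ∂(nu n)

/-- The unitarily invariant kernel `(x, y) ↦ Ψ ⟨x, y⟩` with profile `Ψ`. -/
def invKernel {n : ℕ} (Ψ : ℂ → ℂ) (x y : CSphere n) : ℂ := Ψ (herm x y)

/-- The convolution of the invariant kernel with profile `Ψ` and a function on the sphere. -/
def conv {n : ℕ} (Ψ : ℂ → ℂ) (f : CSphere n → ℂ) (x : CSphere n) : ℂ :=
  ∫ y, f y * invKernel Ψ x y ∂(nu n)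

/-- The functions `χ_s`, `s = 0, 1, 2, …`: the indicator function of `[0, 1]` averaged `s` times
over a window of length `1 / (2 * d)` to the right. -/
def cutoff (d : ℕ) : ℕ → ℝ → ℝ
  | 0 => Set.indicator (Set.Icc 0 1) (fun _ => 1)
  | s + 1 => fun t => 2 * (d : ℝ) * ∫ u in t..(t + 1 / (2 * (d : ℝ))), cutoff d s u

/-- The profile of `∑ k ∈ [a, 2N], χ_d (k / (2N)) * M_k`, where `M k` is the profile of an
invariant kernel and `d` is the dimension of the sphere of `ℂⁿ`. -/
def vpKernel (n : ℕ) (M : ℕ → ℂ → ℂ) (a N : ℕ) : ℂ → ℂ := fun w =>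
  ∑ k ∈ Finset.Icc a (2 * N),
    (cutoff (dim n) (dim n) ((k : ℝ) / (2 * (N : ℝ))) : ℂ) * M k w

/-- The properties of the cutoff function `χ_d`: it is `d - 1` times continuously differentiable
with Lipschitz derivative of order `d - 1`, nonnegative, equal to `1` on `[0, 1/2]`, equal to an
explicit power on the last interval, and a polynomial of degree `d` on each of the `d` intervals of
length `1 / (2 * d)` that make up `[1/2, 1]`. -/
structure IsSmoothCutoff (d : ℕ) (χ : ℝ → ℝ) : Prop where
  contDiff : ContDiff ℝ ((d - 1 : ℕ) : ℕ∞) χ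
  lipschitz : ∃ L : ℝ≥0, LipschitzWith L (iteratedDeriv (d - 1) χ)
  nonneg : ∀ t, 0 ≤ t → 0 ≤ χ t
  eq_one : ∀ t ∈ Set.Icc (0 : ℝ) (1 / 2), χ t = 1
  eq_pow : ∀ t ∈ Set.Icc (1 - 1 / (2 * (d : ℝ))) 1,
    χ t = (2 * (d : ℝ)) ^ d / (d.factorial : ℝ) * (1 - t) ^ d
  eq_poly : ∀ s ∈ Finset.Icc 1 d, ∃ p : Polynomial ℝ, p.natDegree = d ∧
    ∀ t ∈ Set.Icc (1 - (s : ℝ) / (2 * (d : ℝ))) (1 - ((s : ℝ) - 1) / (2 * (d : ℝ))),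
      χ t = p.eval t

end ComplexSphere

end

/-! Write Z_k(t) for `zonalPoly (n - 1) k`, to be taken at t = Re ⟨x, e⟩. The Z_k are the
coefficients in r of the Poisson kernel (1 - r²) / (1 - 2tr + r²)ⁿ of the unit ball of ℝ²ⁿ; up to a
power of r and a constant, this series is the Poisson kernel of the circle differentiated n - 1
times in t. In particular the reproducing profiles are real and depend only on the real part of the
Hermitian product.

The L₁ bound rests on positivity. Multiplying the generating series by (1 - r)^(-2n) produces the
unnormalized Cesàro kernels of order d = 2n - 1, and the product factors into series with
nonnegative coefficients (`cesaroKernel_nonneg`). Their L₁ norms are therefore their integrals, the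
binomials (d + m choose d). By d + 1 summations by parts, the sum of χ_d(k / 2N) Z_k becomes a
combination of Cesàro kernels whose weights are the differences of order d + 1 of k ↦ χ_d(k / 2N).
As χ_d is a spline of degree d with knots 1 - i / (2d) on [0, ∞), these differences are O(N^(-d))
and live on boundedly many indices near the scaled knots, while the binomials are O(N^d); see
`exists_sum_abs_fwdDiff_cutoff_le`.

The reproducing property uses neither the dimension of H_k, nor an addition theorem, nor
completeness. The Gegenbauer equation makes Z_k(Re ⟨·, e⟩) an eigenfunction, and Green's identity
makes eigenfunctions of different eigenvalues orthogonal. So integrating f ∈ H_k against the m-th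
Cesàro kernel leaves (d + m - k choose d) ∫ f Z_k. Divided by their integrals, the Cesàro kernels
are a positive approximate identity at e: testing them against 1 and Re ⟨x, e⟩ suffices, as in
Korovkin's theorem. The binomial ratio tends to 1, whence ∫ f Z_k = f(e) (`integral_mul_zonalPoly`).
Reproduction of T_N by Q then follows from orthogonality and χ_d = 1 on [0, 1/2]. -/

noncomputable section

namespace ComplexSphere

/-! ### Truncated powers and the cutoff function -/

/-- The truncated power `x ↦ x₊ ^ s`, equal to the indicator of `[0, ∞)` for `s = 0`. -/
def truncPow (s : ℕ) (x : ℝ) : ℝ := if 0 ≤ x then x ^ s else 0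

theorem truncPow_of_nonneg (s : ℕ) {x : ℝ} (hx : 0 ≤ x) : truncPow s x = x ^ s := if_pos hx

theorem truncPow_of_neg (s : ℕ) {x : ℝ} (hx : x < 0) : truncPow s x = 0 := if_neg hx.not_ge

theorem truncPow_of_nonpos {s : ℕ} (hs : s ≠ 0) {x : ℝ} (hx : x ≤ 0) : truncPow s x = 0 := by
  rcases hx.lt_or_eq with h | rfl
  · exact truncPow_of_neg s h
  · simp [truncPow, hs]

theorem truncPow_nonneg (s : ℕ) (x : ℝ) : 0 ≤ truncPow s x := by
  unfold truncPow
  split_ifs with h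
  · positivity
  · exact le_rfl

theorem monotone_truncPow (s : ℕ) : Monotone (truncPow s) := by
  intro x y hxy
  rcases lt_or_ge x 0 with hx | hx
  · rw [truncPow_of_neg s hx]
    exact truncPow_nonneg s y
  · rw [truncPow_of_nonneg s hx, truncPow_of_nonneg s (hx.trans hxy)]
    gcongr

theorem truncPow_mul (s : ℕ) {c : ℝ} (hc : 0 < c) (x : ℝ) :
    truncPow s (c * x) = c ^ s * truncPow s x := by
  rcases lt_or_ge x 0 with hx | hx
  · rw [truncPow_of_neg s hx, truncPow_of_neg s (mul_neg_of_pos_of_neg hc hx), mul_zero]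
  · rw [truncPow_of_nonneg s hx, truncPow_of_nonneg s (by positivity), mul_pow]

theorem intervalIntegrable_truncPow (s : ℕ) (a b : ℝ) :
    IntervalIntegrable (truncPow s) volume a b :=
  (monotone_truncPow s).intervalIntegrable

theorem integral_truncPow_zero (s : ℕ) (b : ℝ) :
    ∫ u in (0 : ℝ)..b, truncPow s u = truncPow (s + 1) b / (s + 1) := by
  rcases le_or_gt 0 b with hb | hb
  · have : ∫ u in (0 : ℝ)..b, truncPow s u = ∫ u in (0 : ℝ)..b, u ^ s := by
      refine intervalIntegral.integral_congr fun u hu => ?_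
      rw [Set.uIcc_of_le hb] at hu
      exact truncPow_of_nonneg s hu.1
    rw [this, integral_pow, truncPow_of_nonneg _ hb]
    simp
  -- For `s = 0` the integrand equals 1 at the endpoint 0, so the comparison is made on the open
  -- interval.
  · have : ∫ u in (0 : ℝ)..b, truncPow s u = ∫ u in (0 : ℝ)..b, (0 : ℝ) := by
      rw [intervalIntegral.integral_symm, intervalIntegral.integral_symm b 0,
        intervalIntegral.integral_of_le hb.le, intervalIntegral.integral_of_le hb.le,
        integral_Ioc_eq_integral_Ioo, integral_Ioc_eq_integral_Ioo]
      congr 1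
      exact setIntegral_congr_fun measurableSet_Ioo fun u hu => truncPow_of_neg s hu.2
    rw [this, truncPow_of_neg _ hb]
    simp

theorem integral_truncPow (s : ℕ) (a b : ℝ) :
    ∫ u in a..b, truncPow s u = (truncPow (s + 1) b - truncPow (s + 1) a) / (s + 1) := by
  rw [← intervalIntegral.integral_interval_sub_left (intervalIntegrable_truncPow s 0 b)
    (intervalIntegrable_truncPow s 0 a), integral_truncPow_zero, integral_truncPow_zero, sub_div]

theorem integral_truncPow_sub (s : ℕ) (c a b : ℝ) :
    ∫ u in a..b, truncPow s (c - u) =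
      -((truncPow (s + 1) (c - b) - truncPow (s + 1) (c - a)) / (s + 1)) := by
  rw [intervalIntegral.integral_comp_sub_left (fun u => truncPow s u), integral_truncPow]
  ring

/-- The cutoff function on `[0, ∞)` as an iterated difference of a truncated power. -/
theorem cutoff_eq_fwdDiff (d : ℕ) (s : ℕ) {t : ℝ} (ht : 0 ≤ t) :
    cutoff d s t = (2 * (d : ℝ)) ^ s / (s.factorial : ℝ) * ((-1) ^ s *
      (fwdDiff (1 / (2 * (d : ℝ))))^[s] (fun u => truncPow s (1 - u)) t) := by
  induction s generalizing t with
  | zero =>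
    simp only [cutoff, Function.iterate_zero, id, truncPow, Set.indicator, Set.mem_Icc]
    by_cases h : t ≤ 1 <;> simp [h, ht]
  | succ s ih =>
    set h : ℝ := 1 / (2 * (d : ℝ)) with hh
    have hpos : 0 ≤ h := by positivity
    have key : ∫ u in t..(t + h), cutoff d s u =
        (2 * (d : ℝ)) ^ s / (s.factorial : ℝ) * ((-1) ^ (s + 1) / (s + 1) *
          (fwdDiff h)^[s + 1] (fun u => truncPow (s + 1) (1 - u)) t) := by
      -- Expanded into translates, each truncated power integrates to one of the next order, and
      -- evaluation at the two ends of the window supplies the extra difference. The window lies to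
      -- the right of `t`, so `0 ≤ u` and the left edge of the indicator is never seen.
      have h1 : ∫ u in t..(t + h), cutoff d s u = ∫ u in t..(t + h),
          (2 * (d : ℝ)) ^ s / (s.factorial : ℝ) * ((-1) ^ s *
            ∑ k ∈ Finset.range (s + 1), (((-1 : ℤ) ^ (s - k) * (s.choose k : ℤ) : ℤ) : ℝ) *
              truncPow s ((1 - k * h) - u)) := by
        refine intervalIntegral.integral_congr fun u hu => ?_
        rw [Set.uIcc_of_le (by linarith)] at hu
        rw [ih (ht.trans hu.1), fwdDiff_iter_eq_sum_shift]
        congr 2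
        refine Finset.sum_congr rfl fun k _ => ?_
        rw [zsmul_eq_mul, nsmul_eq_mul]
        congr 2
        ring
      rw [h1, intervalIntegral.integral_const_mul, intervalIntegral.integral_const_mul,
        intervalIntegral.integral_finsetSum]
      · rw [Function.iterate_succ_apply, fwdDiff_iter_eq_sum_shift]
        congr 1
        rw [Finset.mul_sum, Finset.mul_sum]
        refine Finset.sum_congr rfl fun k _ => ?_
        rw [intervalIntegral.integral_const_mul, integral_truncPow_sub, zsmul_eq_mul, nsmul_eq_mul,
          fwdDiff, show 1 - (t + k * h + h) = 1 - k * h - (t + h) by ring,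
          show 1 - (t + k * h) = 1 - k * h - t by ring]
        ring
      · intro k _
        refine IntervalIntegrable.const_mul ?_ _
        refine (Antitone.intervalIntegrable fun a b hab => ?_)
        exact monotone_truncPow s (by linarith)
    have h2 : cutoff d (s + 1) t = 2 * (d : ℝ) * ∫ u in t..(t + h), cutoff d s u := rfl
    rw [h2, key, Nat.factorial_succ]
    push_cast
    have : ((s : ℝ) + 1) ≠ 0 := by positivity
    rw [pow_succ (2 * (d : ℝ)) s]
    field_simp

/-- Spline form with visible knots 1 - k / (2d): the vanishing, the polynomial pieces and the
difference bounds are all read off from it. -/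
theorem cutoff_eq_sum (d : ℕ) (s : ℕ) {t : ℝ} (ht : 0 ≤ t) :
    cutoff d s t = (2 * (d : ℝ)) ^ s / (s.factorial : ℝ) *
      ∑ k ∈ Finset.range (s + 1), (-1) ^ k * (s.choose k : ℝ) *
        truncPow s (1 - k * (1 / (2 * (d : ℝ))) - t) := by
  rw [cutoff_eq_fwdDiff d s ht, fwdDiff_iter_eq_sum_shift, Finset.mul_sum]
  congr 1
  refine Finset.sum_congr rfl fun k hk => ?_
  have hk' : k ≤ s := by simpa [Nat.lt_succ_iff] using hk
  rw [zsmul_eq_mul, nsmul_eq_mul]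
  push_cast
  rw [show 1 - (t + k * (1 / (2 * (d : ℝ)))) = 1 - k * (1 / (2 * (d : ℝ))) - t by ring,
    ← mul_assoc, ← mul_assoc, ← pow_add, show s + (s - k) = 2 * (s - k) + k by omega, pow_add,
    pow_mul]
  norm_num

theorem cutoff_eq_zero {d : ℕ} (hd : 0 < d) {s : ℕ} (hs : s ≠ 0) {t : ℝ} (ht : 1 ≤ t) :
    cutoff d s t = 0 := by
  rw [cutoff_eq_sum d s (by linarith), Finset.sum_eq_zero, mul_zero]
  intro k _
  rw [truncPow_of_nonpos hs, mul_zero]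
  have : 0 ≤ (k : ℝ) * (1 / (2 * (d : ℝ))) := by positivity
  linarith

theorem cutoff_nonneg (d s : ℕ) (t : ℝ) : 0 ≤ cutoff d s t := by
  induction s generalizing t with
  | zero => exact Set.indicator_nonneg (fun _ _ => zero_le_one) t
  | succ s ih =>
    refine mul_nonneg (by positivity) (intervalIntegral.integral_nonneg ?_ fun u _ => ih u)
    have : (0 : ℝ) ≤ 1 / (2 * (d : ℝ)) := by positivity
    linarith

theorem cutoff_eq_one {d : ℕ} (hd : 0 < d) (s : ℕ) {t : ℝ} (ht : 0 ≤ t)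
    (ht' : t ≤ 1 - s * (1 / (2 * (d : ℝ)))) : cutoff d s t = 1 := by
  induction s generalizing t with
  | zero => exact Set.indicator_of_mem (by simpa [ht] using ht') _
  | succ s ih =>
    have hd' : (0 : ℝ) < d := by exact_mod_cast hd
    have hh : (0 : ℝ) ≤ 1 / (2 * (d : ℝ)) := by positivity
    have h1 : ∫ u in t..(t + 1 / (2 * (d : ℝ))), cutoff d s u =
        ∫ u in t..(t + 1 / (2 * (d : ℝ))), (1 : ℝ) := by
      refine intervalIntegral.integral_congr fun u hu => ?_
      rw [Set.uIcc_of_le (by linarith)] at hu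
      push_cast at ht'
      exact ih (ht.trans hu.1) (by linarith [hu.2])
    change 2 * (d : ℝ) * ∫ u in t..(t + 1 / (2 * (d : ℝ))), cutoff d s u = 1
    rw [h1]
    simp
    field_simp

/-! ### Smoothness and polynomial pieces of the cutoff -/

theorem exists_lipschitzWith_average {f : ℝ → ℝ} (hf : ∀ t, |f t| ≤ 1)
    (hi : ∀ a b, IntervalIntegrable f volume a b) (c h : ℝ) :
    ∃ L : ℝ≥0, LipschitzWith L (fun t => c * ∫ u in t..(t + h), f u) := by
  have hL : LipschitzWith 1 (fun t => ∫ u in (0 : ℝ)..t, f u) := by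
    refine LipschitzWith.of_dist_le_mul fun x y => ?_
    rw [Real.dist_eq, intervalIntegral.integral_interval_sub_left (hi _ _) (hi _ _), Real.dist_eq]
    have := intervalIntegral.norm_integral_le_of_norm_le_const (a := y) (b := x) (f := f) (C := 1)
      fun u _ => hf u
    simpa using this
  have h2 : (fun t => c * ∫ u in t..(t + h), f u) =
      fun t => c * ((∫ u in (0 : ℝ)..(t + h), f u) - ∫ u in (0 : ℝ)..t, f u) := by
    funext t
    rw [intervalIntegral.integral_interval_sub_left (hi _ _) (hi _ _)]
  rw [h2]
  have h3 : LipschitzWith (1 * 1) (fun t => ∫ u in (0 : ℝ)..(t + h), f u) :=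
    hL.comp (LipschitzWith.of_dist_le_mul fun x y => by simp)
  refine ⟨_, (lipschitzWith_smul c).comp (h3.sub hL)⟩

theorem abs_cutoff_zero_le (d : ℕ) (t : ℝ) : |cutoff d 0 t| ≤ 1 := by
  simp only [cutoff, Set.indicator]
  split_ifs <;> simp

theorem intervalIntegrable_cutoff_zero (d : ℕ) (a b : ℝ) :
    IntervalIntegrable (cutoff d 0) volume a b :=
  ((integrable_indicator_iff measurableSet_Icc).2
    (integrableOn_const (by simp))).intervalIntegrable

theorem hasDerivAt_average {f : ℝ → ℝ} (hf : Continuous f) (c h t : ℝ) :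
    HasDerivAt (fun t => c * ∫ u in t..(t + h), f u) (c * (f (t + h) - f t)) t := by
  have hi : ∀ a b, IntervalIntegrable f volume a b := fun a b => hf.intervalIntegrable a b
  have h2 : (fun t => c * ∫ u in t..(t + h), f u) =
      fun t => c * ((∫ u in (0 : ℝ)..(t + h), f u) - ∫ u in (0 : ℝ)..t, f u) := by
    funext t
    rw [intervalIntegral.integral_interval_sub_left (hi _ _) (hi _ _)]
  rw [h2]
  have h3 : ∀ x, HasDerivAt (fun t => ∫ u in (0 : ℝ)..t, f u) (f x) x := fun x =>
    hf.integral_hasStrictDerivAt 0 x |>.hasDerivAt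
  exact (((h3 (t + h)).comp_add_const t h).sub (h3 t)).const_mul c

/-- The first average of the bounded, discontinuous indicator is only Lipschitz. The derivative of
each later average is a multiple of a difference of the previous one, so each further averaging
gains one derivative and passes on the Lipschitz bound. -/
theorem contDiff_cutoff (d s : ℕ) :
    ContDiff ℝ (s : ℕ∞) (cutoff d (s + 1)) ∧
      ∃ L : ℝ≥0, LipschitzWith L (iteratedDeriv s (cutoff d (s + 1))) := by
  induction s with
  | zero =>
    obtain ⟨L, hL⟩ := exists_lipschitzWith_average (abs_cutoff_zero_le d)
      (intervalIntegrable_cutoff_zero d) (2 * (d : ℝ)) (1 / (2 * (d : ℝ)))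
    refine ⟨contDiff_zero.2 hL.continuous, L, ?_⟩
    rw [iteratedDeriv_zero]
    exact hL
  | succ s ih =>
    obtain ⟨hc, L, hL⟩ := ih
    set h : ℝ := 1 / (2 * (d : ℝ)) with hh
    set f := cutoff d (s + 1) with hf
    have hder : ∀ t, HasDerivAt (cutoff d (s + 1 + 1)) (2 * (d : ℝ) * (f (t + h) - f t)) t :=
      hasDerivAt_average hc.continuous _ _
    have hderiv : deriv (cutoff d (s + 1 + 1)) = fun t => 2 * (d : ℝ) * (f (t + h) - f t) :=
      funext fun t => (hder t).deriv
    have hc1 : ContDiff ℝ (s : ℕ∞) (fun t => f (t + h)) := hc.comp (contDiff_id.add contDiff_const)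
    refine ⟨?_, ?_⟩
    · have : (((s + 1 : ℕ) : ℕ∞) : WithTop ℕ∞) = ((s : ℕ∞) : WithTop ℕ∞) + 1 := by push_cast; rfl
      rw [this, contDiff_succ_iff_deriv]
      refine ⟨fun t => (hder t).differentiableAt, by simp, ?_⟩
      rw [hderiv]
      exact contDiff_const.mul (hc1.sub hc)
    · rw [iteratedDeriv_succ', hderiv]
      have h4 : iteratedDeriv s (fun t => 2 * (d : ℝ) * (f (t + h) - f t)) =
          fun t => 2 * (d : ℝ) * (iteratedDeriv s f (t + h) - iteratedDeriv s f t) := by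
        funext t
        rw [iteratedDeriv_const_mul_field, iteratedDeriv_fun_sub hc1.contDiffAt hc.contDiffAt,
          iteratedDeriv_comp_add_const]
      rw [h4]
      have h5 : LipschitzWith (L * 1) (fun t => iteratedDeriv s f (t + h)) :=
        hL.comp (LipschitzWith.of_dist_le_mul fun x y => by simp)
      exact ⟨_, (lipschitzWith_smul (2 * (d : ℝ))).comp (h5.sub hL)⟩

/-- On the `s`-th interval from the right exactly the truncated powers with k < s are active. The
degree does not drop because the leading coefficient contains the partial alternating sum of
binomials, which is ±(d - 1 choose s - 1). -/
theorem exists_polynomial_eq_cutoff {d : ℕ} (hd : 0 < d) {s : ℕ} (hs : 1 ≤ s) (hsd : s ≤ d) :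
    ∃ p : Polynomial ℝ, p.natDegree = d ∧
      ∀ t ∈ Set.Icc (1 - (s : ℝ) / (2 * (d : ℝ))) (1 - ((s : ℝ) - 1) / (2 * (d : ℝ))),
        cutoff d d t = p.eval t := by
  have hd' : (0 : ℝ) < d := by exact_mod_cast hd
  have hsd' : (s : ℝ) ≤ d := by exact_mod_cast hsd
  set h : ℝ := 1 / (2 * (d : ℝ)) with hh
  have hpos : 0 < h := by positivity
  have hdh : (d : ℝ) * h = 1 / 2 := by rw [hh]; field_simp
  set c : ℝ := (2 * (d : ℝ)) ^ d / (d.factorial : ℝ) with hc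
  have hc0 : c ≠ 0 := by positivity
  let q : ℕ → Polynomial ℝ := fun k => (Polynomial.C (1 - k * h) - Polynomial.X) ^ d
  have h1 : ∀ a : ℝ, (Polynomial.C a - Polynomial.X).natDegree ≤ 1 := fun a =>
    (Polynomial.natDegree_sub_le _ _).trans (by simp)
  have hqd : ∀ k, (q k).natDegree ≤ d := fun k => by
    refine Polynomial.natDegree_pow_le_of_le d (h1 _) |>.trans (by simp)
  have hqc : ∀ k, (q k).coeff d = (-1) ^ d := fun k => by
    have := Polynomial.coeff_pow_of_natDegree_le (m := d) (h1 (1 - k * h))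
    rw [mul_one] at this
    rw [this, Polynomial.coeff_sub, Polynomial.coeff_C_of_ne_zero one_ne_zero,
      Polynomial.coeff_X_one, zero_sub]
  refine ⟨Polynomial.C c * ∑ k ∈ Finset.range s,
    Polynomial.C ((-1) ^ k * (d.choose k : ℝ)) * q k, ?_, ?_⟩
  · refine Polynomial.natDegree_eq_of_le_of_coeff_ne_zero ?_ ?_
    · refine (Polynomial.natDegree_C_mul_le _ _).trans
        (Polynomial.natDegree_sum_le_of_forall_le _ _ fun k _ => ?_)
      exact (Polynomial.natDegree_C_mul_le _ _).trans (hqd k)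
    · rw [Polynomial.coeff_C_mul, Polynomial.finsetSum_coeff]
      simp only [Polynomial.coeff_C_mul, hqc]
      rw [← Finset.sum_mul]
      refine mul_ne_zero hc0 (mul_ne_zero ?_ (by positivity))
      obtain ⟨e, rfl⟩ : ∃ e, d = e + 1 := ⟨d - 1, by omega⟩
      obtain ⟨r, rfl⟩ : ∃ r, s = r + 1 := ⟨s - 1, by omega⟩
      have := Int.alternating_sum_range_choose_eq_choose (n := e) (m := r)
      have h2 : ∑ k ∈ Finset.range (r + 1), (-1 : ℝ) ^ k * ((e + 1).choose k : ℝ) =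
          (-1) ^ r * (e.choose r : ℝ) := by exact_mod_cast this
      rw [h2]
      refine mul_ne_zero (by positivity) ?_
      have : 0 < e.choose r := Nat.choose_pos (by omega)
      positivity
  · intro t ht
    have hs1 : (s : ℝ) / (2 * (d : ℝ)) = s * h := by rw [hh]; ring
    have hs2 : ((s : ℝ) - 1) / (2 * (d : ℝ)) = (s - 1) * h := by rw [hh]; ring
    rw [hs1, hs2] at ht
    have ht0 : 0 ≤ t := by nlinarith [ht.1]
    rw [cutoff_eq_sum d d ht0, ← hh, ← hc, Polynomial.eval_mul, Polynomial.eval_C,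
      Polynomial.eval_finsetSum]
    congr 1
    symm
    refine (Finset.sum_congr rfl fun k hk => ?_).trans
      (Finset.sum_subset (Finset.range_subset_range.2 (by omega : s ≤ d + 1)) fun k _ hk => ?_)
    · rw [truncPow_of_nonneg]
      · simp [q]
      · have : k + 1 ≤ s := by simpa using hk
        have : (k : ℝ) + 1 ≤ s := by exact_mod_cast this
        nlinarith [ht.2]
    · rw [truncPow_of_nonpos hd.ne', mul_zero]
      have : s ≤ k := by simpa using hk
      have : (s : ℝ) ≤ k := by exact_mod_cast this
      nlinarith [ht.1]

theorem isSmoothCutoff_cutoff {d : ℕ} (hd : 0 < d) : IsSmoothCutoff d (cutoff d d) := by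
  have hd' : (1 : ℝ) ≤ d := by exact_mod_cast hd
  have h := contDiff_cutoff d (d - 1)
  rw [Nat.sub_add_cancel hd] at h
  refine ⟨h.1, h.2, fun t _ => cutoff_nonneg d d t, fun t ht => ?_, fun t ht => ?_, fun s hs => ?_⟩
  · refine cutoff_eq_one hd d ht.1 (ht.2.trans (le_of_eq ?_))
    field_simp
    ring
  · have hh : 1 / (2 * (d : ℝ)) ≤ 1 / 2 := by
      apply one_div_le_one_div_of_le <;> linarith
    rw [cutoff_eq_sum d d (by linarith [ht.1]), Finset.sum_range_succ', Finset.sum_eq_zero]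
    · simp only [pow_zero, Nat.choose_zero_right, Nat.cast_one, Nat.cast_zero, zero_mul, sub_zero,
        zero_add, one_mul]
      rw [truncPow_of_nonneg _ (by linarith [ht.2])]
    · intro k _
      rw [truncPow_of_nonpos hd.ne', mul_zero]
      push_cast
      have : 0 ≤ (k : ℝ) * (1 / (2 * (d : ℝ))) := by positivity
      linarith [ht.1]
  · rw [Finset.mem_Icc] at hs
    exact exists_polynomial_eq_cutoff hd hs.1 hs.2

/-! ### Zonal polynomials -/

open Polynomial (derivative)

/-- The coefficients `1, 2 T₁, 2 T₂, …` of the Poisson kernel of the circle. -/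
def circlePoly (m : ℕ) : Polynomial ℝ :=
  if m = 0 then 1 else 2 * Polynomial.Chebyshev.T ℝ m

/-- The zonal polynomial of degree `k` of the sphere in real dimension `2 * lam + 2`, normalized to
be the profile of a reproducing kernel. -/
def zonalPoly (lam k : ℕ) : Polynomial ℝ :=
  Polynomial.C (((2 ^ lam * lam.factorial : ℕ) : ℝ)⁻¹) * derivative^[lam] (circlePoly (k + lam))

/-- The formal series `1 - 2 x r + r²` in `r`. -/
def poissonDenom : PowerSeries (Polynomial ℝ) :=
  1 - PowerSeries.C (2 * Polynomial.X) * PowerSeries.X + PowerSeries.X ^ 2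

theorem coeff_quadratic_mul {R : Type*} [CommRing R] (a : R) (f : PowerSeries R) (m : ℕ) :
    PowerSeries.coeff (m + 2) ((1 - PowerSeries.C a * PowerSeries.X + PowerSeries.X ^ 2) * f) =
      PowerSeries.coeff (m + 2) f - a * PowerSeries.coeff (m + 1) f + PowerSeries.coeff m f := by
  rw [add_mul, sub_mul, one_mul, mul_assoc, map_add, map_sub, PowerSeries.coeff_C_mul,
    PowerSeries.coeff_succ_X_mul, PowerSeries.coeff_X_pow_mul]

theorem coeff_one_quadratic_mul {R : Type*} [CommRing R] (a : R) (f : PowerSeries R) :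
    PowerSeries.coeff 1 ((1 - PowerSeries.C a * PowerSeries.X + PowerSeries.X ^ 2) * f) =
      PowerSeries.coeff 1 f - a * PowerSeries.coeff 0 f := by
  rw [add_mul, sub_mul, one_mul, mul_assoc, map_add, map_sub, PowerSeries.coeff_C_mul,
    PowerSeries.coeff_succ_X_mul, PowerSeries.coeff_X_pow_mul']
  simp

/-- Poisson kernel of the circle. The Chebyshev recurrence kills all coefficients from r³ on; the
term -r² appears because the constant coefficient is 1 rather than 2 T₀. -/
theorem poissonDenom_mul_mk_circlePoly :
    poissonDenom * PowerSeries.mk circlePoly = 1 - PowerSeries.X ^ 2 := by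
  ext1 m
  unfold poissonDenom
  match m with
  | 0 => simp [circlePoly]
  | 1 =>
    rw [coeff_one_quadratic_mul]
    simp [circlePoly, PowerSeries.coeff_one, PowerSeries.coeff_X_pow]
  | 2 =>
    rw [show 2 = 0 + 2 from rfl, coeff_quadratic_mul]
    simp [circlePoly, PowerSeries.coeff_one, Polynomial.Chebyshev.T_two]
    ring
  | m + 3 =>
    rw [show m + 3 = m + 1 + 2 from rfl, coeff_quadratic_mul]
    have h := Polynomial.Chebyshev.T_add_two ℝ ((m : ℤ) + 1)
    have h0 : (1 : PowerSeries (Polynomial ℝ)).coeff (m + 1 + 2) = 0 := by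
      rw [PowerSeries.coeff_one, if_neg (by omega)]
    have h1 : (PowerSeries.X ^ 2 : PowerSeries (Polynomial ℝ)).coeff (m + 1 + 2) = 0 := by
      rw [PowerSeries.coeff_X_pow, if_neg (by omega)]
    rw [map_sub, h0, h1]
    simp only [PowerSeries.coeff_mk, circlePoly]
    rw [if_neg (by omega), if_neg (by omega), if_neg (by omega)]
    push_cast
    rw [h]
    ring

/-- The coefficientwise derivation of power series over a polynomial ring. -/
def coeffDerivation :
    Derivation ℝ (PowerSeries (Polynomial ℝ)) (PowerSeries (Polynomial ℝ)) :=
  Derivation.mk'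
    { toFun := fun f => PowerSeries.mk fun m => derivative (PowerSeries.coeff m f)
      map_add' := fun f g => by ext1 m; simp
      map_smul' := fun c f => by ext1 m; simp }
    (fun f g => by
      ext1 m
      simp only [LinearMap.coe_mk, AddHom.coe_mk, PowerSeries.coeff_mk, PowerSeries.coeff_mul,
        map_sum, smul_eq_mul, map_add, Polynomial.derivative_mul]
      rw [Finset.sum_add_distrib, add_comm]
      congr 1
      rw [← Finset.Nat.sum_antidiagonal_swap]
      refine Finset.sum_congr rfl fun p _ => ?_
      simp only [Prod.fst_swap, Prod.snd_swap]
      ring)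

theorem coeff_coeffDerivation (f : PowerSeries (Polynomial ℝ)) (m : ℕ) :
    PowerSeries.coeff m (coeffDerivation f) = derivative (PowerSeries.coeff m f) := by
  simp [coeffDerivation]

theorem coeffDerivation_poissonDenom :
    coeffDerivation poissonDenom = -(2 * PowerSeries.X) := by
  ext1 m
  rw [coeff_coeffDerivation, poissonDenom, map_add, map_sub, PowerSeries.coeff_C_mul, map_neg,
    show (2 : PowerSeries (Polynomial ℝ)) = PowerSeries.C 2 from (map_ofNat PowerSeries.C 2).symm,
    PowerSeries.coeff_C_mul, PowerSeries.coeff_X, PowerSeries.coeff_one, PowerSeries.coeff_X_pow]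
  split_ifs <;> simp_all

theorem coeffDerivation_natCast_mul_X_pow (c l : ℕ) :
    coeffDerivation ((c : PowerSeries (Polynomial ℝ)) * PowerSeries.X ^ l *
      (1 - PowerSeries.X ^ 2)) = 0 := by
  have h : coeffDerivation PowerSeries.X = 0 := by
    ext1 m
    rw [coeff_coeffDerivation, PowerSeries.coeff_X]
    split_ifs <;> simp
  simp [Derivation.leibniz, Derivation.leibniz_pow, h]

/-- Differentiate the identity for `l` in x: the right side is constant in x, and the derivative of
the denominator is -2r. Multiplying by the denominator once more and inserting the identity for `l`
gives the next one. -/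
theorem poissonDenom_pow_mul_mk (lam : ℕ) :
    poissonDenom ^ (lam + 1) * PowerSeries.mk (fun m => derivative^[lam] (circlePoly m)) =
      ((2 ^ lam * lam.factorial : ℕ) : PowerSeries (Polynomial ℝ)) * PowerSeries.X ^ lam *
        (1 - PowerSeries.X ^ 2) := by
  induction lam with
  | zero => simpa using poissonDenom_mul_mk_circlePoly
  | succ l ih =>
    have h := congrArg coeffDerivation ih
    have h1 : coeffDerivation (PowerSeries.mk (fun m => derivative^[l] (circlePoly m))) =
        PowerSeries.mk (fun m => derivative^[l + 1] (circlePoly m)) := by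
      ext1 m
      rw [coeff_coeffDerivation, PowerSeries.coeff_mk, PowerSeries.coeff_mk,
        Function.iterate_succ_apply']
    rw [coeffDerivation_natCast_mul_X_pow, Derivation.leibniz, Derivation.leibniz_pow, h1,
      coeffDerivation_poissonDenom] at h
    simp only [smul_eq_mul, nsmul_eq_mul, Nat.add_sub_cancel] at h
    set G := PowerSeries.mk (fun m => derivative^[l] (circlePoly m))
    set G' := PowerSeries.mk (fun m => derivative^[l + 1] (circlePoly m))
    rw [Nat.factorial_succ]
    push_cast at h ih ⊢
    linear_combination poissonDenom * h +
      2 * PowerSeries.X * ((l : PowerSeries (Polynomial ℝ)) + 1) * ih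

theorem natDegree_circlePoly_le (m : ℕ) : (circlePoly m).natDegree ≤ m := by
  unfold circlePoly
  split_ifs with h
  · simp
  · refine (Polynomial.natDegree_mul_le).trans ?_
    simp

/-- The `lam`-th derivative kills the coefficients of index below `lam`, so a factor r^lam and the
constant 2^lam lam! cancel. What remains is the Poisson kernel in real dimension 2 lam + 2. -/
theorem poissonDenom_pow_mul_mk_zonalPoly (lam : ℕ) :
    poissonDenom ^ (lam + 1) * PowerSeries.mk (zonalPoly lam) = 1 - PowerSeries.X ^ 2 := by
  set c : ℕ := 2 ^ lam * lam.factorial with hc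
  have hc0 : c ≠ 0 := by positivity
  have h1 : PowerSeries.mk (fun m => derivative^[lam] (circlePoly m)) =
      (c : PowerSeries (Polynomial ℝ)) * PowerSeries.X ^ lam * PowerSeries.mk (zonalPoly lam) := by
    ext1 m
    rw [mul_assoc, show (c : PowerSeries (Polynomial ℝ)) = PowerSeries.C (c : Polynomial ℝ) by simp,
      PowerSeries.coeff_C_mul, PowerSeries.coeff_X_pow_mul', PowerSeries.coeff_mk]
    split_ifs with h
    · rw [PowerSeries.coeff_mk, zonalPoly, Nat.sub_add_cancel h, ← mul_assoc, ← hc,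
        ← Polynomial.C_eq_natCast, ← Polynomial.C_mul, mul_inv_cancel₀ (by exact_mod_cast hc0)]
      simp
    · rw [mul_zero]
      exact Polynomial.iterate_derivative_eq_zero
        ((natDegree_circlePoly_le m).trans_lt (not_le.1 h))
  have h2 := poissonDenom_pow_mul_mk lam
  rw [h1] at h2
  have h3 : ((c : PowerSeries (Polynomial ℝ)) * PowerSeries.X ^ lam) ≠ 0 := by
    refine mul_ne_zero ?_ (pow_ne_zero _ PowerSeries.X_ne_zero)
    rw [show (c : PowerSeries (Polynomial ℝ)) = PowerSeries.C (c : Polynomial ℝ) by simp]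
    rw [Ne, map_eq_zero_iff _ PowerSeries.C_injective]
    exact_mod_cast hc0
  refine mul_left_cancel₀ h3 ?_
  rw [← h2]
  ring

/-- The generating series of the values of the zonal polynomials at `t`. -/
def zonalSeries (lam : ℕ) (t : ℝ) : PowerSeries ℝ :=
  PowerSeries.mk fun k => (zonalPoly lam k).eval t

theorem quadratic_pow_mul_zonalSeries (lam : ℕ) (t : ℝ) :
    (1 - PowerSeries.C (2 * t) * PowerSeries.X + PowerSeries.X ^ 2) ^ (lam + 1) *
      zonalSeries lam t = 1 - PowerSeries.X ^ 2 := by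
  have h := congrArg (PowerSeries.map (Polynomial.evalRingHom t))
    (poissonDenom_pow_mul_mk_zonalPoly lam)
  have h1 : PowerSeries.map (Polynomial.evalRingHom t) (PowerSeries.mk (zonalPoly lam)) =
      zonalSeries lam t := by
    ext1 m
    simp [zonalSeries]
  have h2 : PowerSeries.map (Polynomial.evalRingHom t) poissonDenom =
      1 - PowerSeries.C (2 * t) * PowerSeries.X + PowerSeries.X ^ 2 := by
    simp [poissonDenom]
  rw [map_mul, map_pow, h1, h2] at h
  simpa using h

theorem zonalPoly_zero (lam : ℕ) : zonalPoly lam 0 = 1 := by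
  have h := congrArg (PowerSeries.constantCoeff) (poissonDenom_pow_mul_mk_zonalPoly lam)
  rw [map_mul, ← PowerSeries.coeff_zero_eq_constantCoeff_apply (PowerSeries.mk _),
    PowerSeries.coeff_mk] at h
  simpa [poissonDenom] using h

theorem zonalPoly_one (lam : ℕ) :
    zonalPoly lam 1 = Polynomial.C (2 * ((lam : ℝ) + 1)) * Polynomial.X := by
  have h := congrArg (PowerSeries.coeff 1) (poissonDenom_pow_mul_mk_zonalPoly lam)
  have h0 : PowerSeries.coeff 0 (poissonDenom ^ (lam + 1)) = 1 := by simp [poissonDenom]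
  have h1 : ∀ l : ℕ, PowerSeries.coeff 1 (poissonDenom ^ l) =
      -((l : Polynomial ℝ) * (2 * Polynomial.X)) := by
    intro l
    induction l with
    | zero => simp [PowerSeries.coeff_one]
    | succ l ih =>
      rw [pow_succ', poissonDenom, coeff_one_quadratic_mul, ← poissonDenom, ih]
      have : PowerSeries.coeff 0 (poissonDenom ^ l) = 1 := by simp [poissonDenom]
      rw [this]
      push_cast
      ring
  rw [PowerSeries.coeff_mul, Finset.Nat.sum_antidiagonal_eq_sum_range_succ
    (fun i j => PowerSeries.coeff i (poissonDenom ^ (lam + 1)) *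
      PowerSeries.coeff j (PowerSeries.mk (zonalPoly lam))), Finset.sum_range_succ,
    Finset.sum_range_one, PowerSeries.coeff_mk, PowerSeries.coeff_mk, Nat.sub_zero,
    Nat.sub_self] at h
  rw [h0, h1, zonalPoly_zero] at h
  simp [PowerSeries.coeff_one, PowerSeries.coeff_X_pow] at h
  simp only [map_mul, map_add, map_natCast, map_one, map_ofNat]
  linear_combination h

/-- The Gegenbauer differential equation. -/
theorem zonalPoly_ode (lam k : ℕ) :
    (1 - Polynomial.X ^ 2) * derivative (derivative (zonalPoly lam k)) -
      Polynomial.C (2 * (lam : ℝ) + 1) * Polynomial.X * derivative (zonalPoly lam k) +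
      Polynomial.C ((k : ℝ) * (k + 2 * lam)) * zonalPoly lam k = 0 := by
  rcases Nat.eq_zero_or_pos (k + lam) with h0 | h0
  · obtain ⟨rfl, rfl⟩ : k = 0 ∧ lam = 0 := by omega
    simp [zonalPoly, circlePoly]
  · have h := Polynomial.Chebyshev.one_sub_X_sq_mul_iterate_derivative_T_eq_poly_in_T (R := ℝ)
      ((k + lam : ℕ) : ℤ) lam
    have hz : zonalPoly lam k = Polynomial.C (((2 ^ lam * lam.factorial : ℕ) : ℝ)⁻¹ * 2) *
        derivative^[lam] (Polynomial.Chebyshev.T ℝ ((k + lam : ℕ) : ℤ)) := by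
      rw [zonalPoly, circlePoly, if_neg h0.ne', ← map_ofNat Polynomial.C 2,
        Polynomial.iterate_derivative_C_mul, Polynomial.C_mul, mul_assoc]
    rw [hz]
    simp only [Polynomial.derivative_C_mul, ← Function.iterate_succ_apply']
    simp only [Function.iterate_succ_apply', map_add, map_mul, map_natCast, map_one,
      map_ofNat] at h ⊢
    rw [Int.cast_natCast, Nat.cast_add (R := Polynomial ℝ)] at h
    linear_combination Polynomial.C (((2 ^ lam * lam.factorial : ℕ) : ℝ)⁻¹) * 2 * h

/-! ### Positivity of the Cesàro kernels -/

/-- With c = cos φ and t = cos 2φ, the squares U_m(c)² = sin²((m + 1)φ) / sin² φ satisfy the third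
order recurrence with characteristic roots 1 and e^(±2iφ), encoded by (1 - r)(1 - 2tr + r²). These
squares are the source of positivity. -/
theorem mk_sq_U_eval (t : ℝ) {c : ℝ} (hc : 2 * c ^ 2 = 1 + t) :
    (1 - PowerSeries.X) * (1 - PowerSeries.C (2 * t) * PowerSeries.X + PowerSeries.X ^ 2) *
      PowerSeries.mk (fun m : ℕ => ((Polynomial.Chebyshev.U ℝ m).eval c) ^ 2) =
        1 + PowerSeries.X := by
  have ht : t = 2 * c ^ 2 - 1 := by linarith
  subst ht
  rw [mul_comm (1 - PowerSeries.X), mul_assoc]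
  have hcoef : ∀ (m : ℕ) (f : PowerSeries ℝ), PowerSeries.coeff (m + 1) ((1 - PowerSeries.X) * f) =
      PowerSeries.coeff (m + 1) f - PowerSeries.coeff m f := by
    intro m f
    rw [sub_mul, one_mul, map_sub, PowerSeries.coeff_succ_X_mul]
  have hcoef0 : ∀ (f : PowerSeries ℝ), PowerSeries.coeff 0 ((1 - PowerSeries.X) * f) =
      PowerSeries.coeff 0 f := by
    intro f
    simp [PowerSeries.coeff_zero_eq_constantCoeff]
  ext1 m
  match m with
  | 0 => simp
  | 1 =>
    rw [coeff_one_quadratic_mul, hcoef 0, hcoef0]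
    simp [PowerSeries.coeff_one]
    ring
  | 2 =>
    rw [show PowerSeries.coeff (R := ℝ) 2 = PowerSeries.coeff (0 + 2) from rfl,
      coeff_quadratic_mul, hcoef (0 + 1), hcoef 0, hcoef0]
    simp [PowerSeries.coeff_one, PowerSeries.coeff_X, Polynomial.Chebyshev.U_two]
    ring
  | m + 3 =>
    rw [show m + 3 = m + 1 + 2 from rfl, coeff_quadratic_mul, hcoef (m + 2), hcoef (m + 1), hcoef m]
    have h2 := congrArg (Polynomial.eval c) (Polynomial.Chebyshev.U_add_two ℝ (m : ℤ))
    have h3 := congrArg (Polynomial.eval c) (Polynomial.Chebyshev.U_add_two ℝ ((m : ℤ) + 1))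
    rw [show (m : ℤ) + 1 + 1 = m + 2 by ring, show (m : ℤ) + 1 + 2 = m + 3 by ring] at h3
    simp only [Polynomial.eval_sub, Polynomial.eval_mul, Polynomial.eval_X,
      Polynomial.eval_ofNat] at h2 h3
    simp only [PowerSeries.coeff_mk, map_add, PowerSeries.coeff_one, PowerSeries.coeff_X]
    rw [if_neg (by omega), if_neg (by omega)]
    push_cast
    rw [show (m : ℤ) + 2 + 1 = m + 3 by ring, show (m : ℤ) + 1 + 1 = m + 2 by ring, h3, h2]
    ring

theorem coeff_mul_nonneg {f g : PowerSeries ℝ} (hf : ∀ m, 0 ≤ PowerSeries.coeff m f)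
    (hg : ∀ m, 0 ≤ PowerSeries.coeff m g) (m : ℕ) : 0 ≤ PowerSeries.coeff m (f * g) := by
  rw [PowerSeries.coeff_mul]
  exact Finset.sum_nonneg fun p _ => mul_nonneg (hf _) (hg _)

theorem coeff_pow_nonneg {f : PowerSeries ℝ} (hf : ∀ m, 0 ≤ PowerSeries.coeff m f) (l m : ℕ) :
    0 ≤ PowerSeries.coeff m (f ^ l) := by
  induction l generalizing m with
  | zero =>
    rw [pow_zero, PowerSeries.coeff_one]
    split_ifs <;> simp
  | succ l ih =>
    rw [pow_succ]
    exact coeff_mul_nonneg ih hf m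

/-- The unnormalized Cesàro kernel of order `2 * lam + 1`. -/
def cesaroKernel (lam m : ℕ) (t : ℝ) : ℝ :=
  PowerSeries.coeff m
    ((PowerSeries.invOneSubPow ℝ (2 * lam + 2)).val * zonalSeries lam t)

theorem cesaroKernel_eq_sum (lam m : ℕ) (t : ℝ) :
    cesaroKernel lam m t = ∑ j ∈ Finset.range (m + 1),
      ((2 * lam + 1 + (m - j)).choose (2 * lam + 1) : ℝ) * (zonalPoly lam j).eval t := by
  rw [cesaroKernel, mul_comm, PowerSeries.coeff_mul, Finset.Nat.sum_antidiagonal_eq_sum_range_succ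
    (fun i j => PowerSeries.coeff i (zonalSeries lam t) *
      PowerSeries.coeff j (PowerSeries.invOneSubPow ℝ (2 * lam + 2)).val)]
  refine Finset.sum_congr rfl fun j _ => ?_
  rw [PowerSeries.invOneSubPow_val_succ_eq_mk_add_choose, PowerSeries.coeff_mk, zonalSeries,
    PowerSeries.coeff_mk, mul_comm]

theorem cesaroKernel_nonneg (lam m : ℕ) {t : ℝ} (ht : -1 ≤ t) : 0 ≤ cesaroKernel lam m t := by
  obtain ⟨c, hc⟩ : ∃ c : ℝ, 2 * c ^ 2 = 1 + t :=
    ⟨Real.sqrt ((1 + t) / 2), by rw [Real.sq_sqrt (by linarith)]; ring⟩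
  have hA := mk_sq_U_eval t hc
  set A : PowerSeries ℝ :=
    PowerSeries.mk (fun m : ℕ => ((Polynomial.Chebyshev.U ℝ m).eval c) ^ 2) with hAdef
  set V : PowerSeries ℝ := 1 - PowerSeries.C (2 * t) * PowerSeries.X + PowerSeries.X ^ 2 with hV
  set B : PowerSeries ℝ := PowerSeries.mk (fun m : ℕ => if Even m then 1 else 0) with hBdef
  have hB : (1 - PowerSeries.X ^ 2) * B = 1 := by
    ext1 m
    rw [sub_mul, one_mul, map_sub, PowerSeries.coeff_X_pow_mul', PowerSeries.coeff_one]
    match m with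
    | 0 => simp [hBdef]
    | 1 => simp [hBdef]
    | m + 2 => simp [hBdef, Nat.even_add]
  have hI : (PowerSeries.invOneSubPow ℝ (2 * lam + 2)).val * (1 - PowerSeries.X) ^ (2 * lam + 2) =
      1 := by
    rw [← PowerSeries.invOneSubPow_inv_eq_one_sub_pow]
    exact (PowerSeries.invOneSubPow ℝ (2 * lam + 2)).val_inv
  have hP := quadratic_pow_mul_zonalSeries lam t
  rw [← hV] at hP
  set I := (PowerSeries.invOneSubPow ℝ (2 * lam + 2)).val with hIdef
  have hX : (1 - PowerSeries.X : PowerSeries ℝ) ≠ 0 := by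
    intro h
    simpa using congrArg PowerSeries.constantCoeff h
  have hV0 : V ≠ 0 := by
    intro h
    simpa [hV] using congrArg PowerSeries.constantCoeff h
  -- Here A = (1 + r) / ((1 - r) V) and B = 1 / (1 - r²). The exponent 2 lam + 2 of `I` is exactly
  -- what lets (1 - r²) / ((1 - r)^(2 lam + 2) V^(lam + 1)) split into these factors with
  -- nonnegative coefficients.
  have key : I * zonalSeries lam t = A ^ (lam + 1) * B ^ lam := by
    refine mul_left_cancel₀ (mul_ne_zero (pow_ne_zero (2 * lam + 2) hX)
      (pow_ne_zero (lam + 1) hV0)) ?_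
    calc (1 - PowerSeries.X) ^ (2 * lam + 2) * V ^ (lam + 1) * (I * zonalSeries lam t)
        = (I * (1 - PowerSeries.X) ^ (2 * lam + 2)) * (V ^ (lam + 1) * zonalSeries lam t) := by
          ring
      _ = 1 - PowerSeries.X ^ 2 := by rw [hI, hP, one_mul]
      _ = (1 - PowerSeries.X ^ 2) * ((1 - PowerSeries.X ^ 2) * B) ^ lam := by
          rw [hB, one_pow, mul_one]
      _ = (1 - PowerSeries.X) ^ (lam + 1) * (1 + PowerSeries.X) ^ (lam + 1) * B ^ lam := by
          rw [← mul_pow, show (1 - PowerSeries.X : PowerSeries ℝ) * (1 + PowerSeries.X) =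
            1 - PowerSeries.X ^ 2 by ring, mul_pow]
          ring
      _ = (1 - PowerSeries.X) ^ (lam + 1) * ((1 - PowerSeries.X) * V * A) ^ (lam + 1) *
          B ^ lam := by
          rw [hA]
      _ = _ := by
          generalize (1 - PowerSeries.X : PowerSeries ℝ) = Y
          rw [mul_pow, mul_pow]
          ring
  rw [cesaroKernel, ← hIdef, key]
  refine coeff_mul_nonneg (fun j => coeff_pow_nonneg (fun i => ?_) _ j)
    (fun j => coeff_pow_nonneg (fun i => ?_) _ j) m
  · rw [hAdef, PowerSeries.coeff_mk]
    positivity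
  · rw [hBdef, PowerSeries.coeff_mk]
    split_ifs <;> simp

/-! ### Iterated summation by parts -/

theorem sum_range_mul_eq_sum_sub_mul (g a : ℕ → ℝ) (K : ℕ) :
    ∑ k ∈ Finset.range K, g k * a k =
      ∑ k ∈ Finset.range K, (g k - g (k + 1)) * ∑ i ∈ Finset.range (k + 1), a i +
        g K * ∑ i ∈ Finset.range K, a i := by
  induction K with
  | zero => simp
  | succ K ih =>
    rw [Finset.sum_range_succ, ih, Finset.sum_range_succ _ K, Finset.sum_range_succ a K]
    ring

/-- Multiplying by 1 / (1 - r) forms partial sums. -/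
theorem coeff_invOneSubPow_succ_mul (s k : ℕ) (f : PowerSeries ℝ) :
    PowerSeries.coeff k ((PowerSeries.invOneSubPow ℝ (s + 1)).val * f) =
      ∑ i ∈ Finset.range (k + 1),
        PowerSeries.coeff i ((PowerSeries.invOneSubPow ℝ s).val * f) := by
  rw [PowerSeries.invOneSubPow_add, Units.val_mul, mul_right_comm, PowerSeries.coeff_mul,
    Finset.Nat.sum_antidiagonal_eq_sum_range_succ
      (fun i j => PowerSeries.coeff i ((PowerSeries.invOneSubPow ℝ s).val * f) *
        PowerSeries.coeff j (PowerSeries.invOneSubPow ℝ 1).val)]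
  refine Finset.sum_congr rfl fun i _ => ?_
  rw [show (1 : ℕ) = 0 + 1 from rfl, PowerSeries.invOneSubPow_val_succ_eq_mk_add_choose]
  simp

/-- Abel summation repeated `s` times; no boundary terms arise because all differences of `g` vanish
from `K` on. For `s = d + 1` the partial sums are the Cesàro kernels of order d. -/
theorem sum_mul_coeff_eq_sum_fwdDiff {g : ℕ → ℝ} {K : ℕ} (hg : ∀ k, K ≤ k → g k = 0)
    (f : PowerSeries ℝ) (s : ℕ) :
    ∑ k ∈ Finset.range K, g k * PowerSeries.coeff k f =
      ∑ k ∈ Finset.range K, (-1) ^ s * (fwdDiff 1)^[s] g k *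
        PowerSeries.coeff k ((PowerSeries.invOneSubPow ℝ s).val * f) := by
  have hz : ∀ s k, K ≤ k → (fwdDiff 1)^[s] g k = 0 := by
    intro s k hk
    rw [fwdDiff_iter_eq_sum_shift]
    refine Finset.sum_eq_zero fun j _ => ?_
    rw [hg _ (by simp; omega), smul_zero]
  induction s with
  | zero => simp [PowerSeries.invOneSubPow_zero]
  | succ s ih =>
    rw [ih, sum_range_mul_eq_sum_sub_mul, hz s K le_rfl, mul_zero, zero_mul, add_zero]
    refine Finset.sum_congr rfl fun k _ => ?_
    rw [coeff_invOneSubPow_succ_mul, Function.iterate_succ_apply', fwdDiff]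
    ring

/-! ### Differences of the cutoff function -/

theorem fwdDiff_iter_truncPow_eq_zero_of_le {d : ℕ} (hd : d ≠ 0) {b : ℝ} {k : ℕ} (hk : b ≤ k)
    (s : ℕ) : (fwdDiff 1)^[s] (fun k : ℕ => truncPow d (b - k)) k = 0 := by
  rw [fwdDiff_iter_eq_sum_shift]
  refine Finset.sum_eq_zero fun j _ => ?_
  rw [truncPow_of_nonpos hd, smul_zero]
  push_cast
  have : (0 : ℝ) ≤ j • (1 : ℝ) := by positivity
  simp only [nsmul_eq_mul, mul_one] at this ⊢
  linarith

/-- All nodes k, …, k + d + 1 lie where the truncated power is a genuine polynomial of degree at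
most d, which a difference of order d + 1 annihilates. -/
theorem fwdDiff_iter_truncPow_eq_zero_of_add_le {d : ℕ} {b : ℝ} {k : ℕ}
    (hk : (k : ℝ) + (d + 1) ≤ b) :
    (fwdDiff 1)^[d + 1] (fun k : ℕ => truncPow d (b - k)) k = 0 := by
  have hdeg : ((Polynomial.C b - Polynomial.X : Polynomial ℝ) ^ d).natDegree < d + 1 := by
    refine Nat.lt_succ_of_le ((Polynomial.natDegree_pow_le_of_le d (m := 1) ?_).trans (by simp))
    exact (Polynomial.natDegree_sub_le _ _).trans (by simp)
  have h := congrFun (Polynomial.fwdDiff_iter_eq_zero_of_degree_lt hdeg) (k : ℝ)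
  rw [fwdDiff_iter_eq_sum_shift] at h ⊢
  rw [Pi.zero_apply] at h
  rw [← h]
  refine Finset.sum_congr rfl fun j hj => ?_
  have hj : (j : ℝ) ≤ d + 1 := by
    have : j ≤ d + 1 := by simpa [Nat.lt_succ_iff] using hj
    exact_mod_cast this
  rw [truncPow_of_nonneg]
  · simp
  · simp
    linarith

theorem abs_fwdDiff_iter_truncPow_le {d : ℕ} {b : ℝ} {k : ℕ} (hk : b < (k : ℝ) + (d + 1)) :
    |(fwdDiff 1)^[d + 1] (fun k : ℕ => truncPow d (b - k)) k| ≤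
      2 ^ (d + 1) * ((d : ℝ) + 1) ^ d := by
  rw [fwdDiff_iter_eq_sum_shift]
  have hsum : (∑ j ∈ Finset.range (d + 1 + 1), ((d + 1).choose j : ℝ)) = 2 ^ (d + 1) := by
    exact_mod_cast Nat.sum_range_choose (d + 1)
  rw [← hsum, Finset.sum_mul]
  refine (Finset.abs_sum_le_sum_abs _ _).trans (Finset.sum_le_sum fun j _ => ?_)
  rw [zsmul_eq_mul, abs_mul]
  push_cast
  rw [abs_mul, abs_pow, abs_neg, abs_one, one_pow, one_mul, Nat.abs_cast,
    abs_of_nonneg (truncPow_nonneg _ _)]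
  gcongr
  rw [← truncPow_of_nonneg d (by positivity : (0 : ℝ) ≤ d + 1)]
  refine monotone_truncPow d ?_
  have : (0 : ℝ) ≤ j := by positivity
  simp
  linarith

theorem sum_abs_fwdDiff_iter_truncPow_le {d : ℕ} (hd : d ≠ 0) (b : ℝ) (K : ℕ) :
    ∑ k ∈ Finset.range K, |(fwdDiff 1)^[d + 1] (fun k : ℕ => truncPow d (b - k)) k| ≤
      ((d : ℝ) + 1) * (2 ^ (d + 1) * ((d : ℝ) + 1) ^ d) := by
  set F : ℕ → ℝ := fun k => |(fwdDiff 1)^[d + 1] (fun k : ℕ => truncPow d (b - k)) k| with hF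
  -- A nonzero difference requires k < b < k + d + 1, that is, a knot strictly inside the stencil;
  -- this leaves at most d + 1 indices.
  set J := Finset.Icc (⌊b⌋₊ - d) ⌊b⌋₊ with hJ
  have hzero : ∀ k ∉ J, F k = 0 := by
    intro k hk
    rw [hF]
    simp only [abs_eq_zero]
    by_contra hne
    apply hk
    have h1 : (k : ℝ) < b := by
      by_contra h
      exact hne (fwdDiff_iter_truncPow_eq_zero_of_le hd (not_lt.1 h) _)
    have h2 : b < (k : ℝ) + (d + 1) := by
      by_contra h
      exact hne (fwdDiff_iter_truncPow_eq_zero_of_add_le (not_lt.1 h))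
    have hb : 0 ≤ b := (Nat.cast_nonneg k).trans h1.le
    have h3 : k ≤ ⌊b⌋₊ := Nat.le_floor h1.le
    have h4 : ⌊b⌋₊ < k + (d + 1) := (Nat.floor_lt hb).2 (by push_cast; exact h2)
    rw [hJ, Finset.mem_Icc]
    omega
  have hbound : ∀ k, F k ≤ 2 ^ (d + 1) * ((d : ℝ) + 1) ^ d := by
    intro k
    by_cases h : (k : ℝ) + (d + 1) ≤ b
    · simp only [hF, fwdDiff_iter_truncPow_eq_zero_of_add_le h, abs_zero]
      positivity
    · exact abs_fwdDiff_iter_truncPow_le (not_le.1 h)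
  calc ∑ k ∈ Finset.range K, F k = ∑ k ∈ Finset.range K ∩ J, F k := by
        refine (Finset.sum_subset Finset.inter_subset_left fun k hk hk' => hzero k ?_).symm
        intro h
        exact hk' (Finset.mem_inter.2 ⟨hk, h⟩)
    _ ≤ ∑ k ∈ J, F k :=
        Finset.sum_le_sum_of_subset_of_nonneg Finset.inter_subset_right fun k _ _ => abs_nonneg _
    _ ≤ J.card • (2 ^ (d + 1) * ((d : ℝ) + 1) ^ d) :=
        Finset.sum_le_card_nsmul _ _ _ fun k _ => hbound k
    _ ≤ _ := by
        rw [nsmul_eq_mul]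
        gcongr
        have : J.card ≤ d + 1 := by
          rw [hJ, Nat.card_Icc]
          omega
        exact_mod_cast this

theorem cutoff_div_eq_sum {d N : ℕ} (hN : 1 ≤ N) (k : ℕ) :
    cutoff d d ((k : ℝ) / (2 * N)) = ((2 * (d : ℝ)) ^ d / (d.factorial : ℝ) / (2 * (N : ℝ)) ^ d) *
      ∑ i ∈ Finset.range (d + 1), (-1) ^ i * (d.choose i : ℝ) *
        truncPow d (2 * (N : ℝ) * (1 - i * (1 / (2 * (d : ℝ)))) - k) := by
  have hN' : (0 : ℝ) < 2 * (N : ℝ) := by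
    have : (1 : ℝ) ≤ N := by exact_mod_cast hN
    linarith
  rw [cutoff_eq_sum d d (by positivity), div_mul_eq_mul_div _ ((2 * (N : ℝ)) ^ d), mul_div_assoc,
    Finset.sum_div]
  congr 1
  refine Finset.sum_congr rfl fun i _ => ?_
  have h : 2 * (N : ℝ) * (1 - i * (1 / (2 * (d : ℝ)))) - k =
      2 * (N : ℝ) * (1 - i * (1 / (2 * (d : ℝ))) - (k : ℝ) / (2 * N)) := by
    field_simp
  rw [h, truncPow_mul d hN']
  field_simp

/-- The differences of order `d + 1` of the sampled cutoff function, weighted by the `L₁` norms of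
the Cesàro kernels of order `d`, are summable uniformly in `N`. -/
theorem exists_sum_abs_fwdDiff_cutoff_le {d : ℕ} (hd : d ≠ 0) :
    ∃ C : ℝ≥0, ∀ N : ℕ, 1 ≤ N → ∑ k ∈ Finset.range (2 * N + 1),
      |(fwdDiff 1)^[d + 1] (fun k : ℕ => cutoff d d ((k : ℝ) / (2 * N))) k| *
        ((d + k).choose d : ℝ) ≤ C := by
  set B : ℝ := ((d : ℝ) + 1) * (2 ^ (d + 1) * ((d : ℝ) + 1) ^ d) with hB
  set c : ℝ := (2 * (d : ℝ)) ^ d / (d.factorial : ℝ) with hc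
  have hB0 : 0 ≤ B := by positivity
  have hc0 : 0 ≤ c := by positivity
  -- `c` is the spline prefactor, `2 ^ d` the sum of its binomial weights, `B` the bound for one
  -- knot. The last factor comes from (d + k choose d) ≤ ((d + 1) 2N)^d, whose power of 2N cancels
  -- the one in the rescaled spline.
  refine ⟨⟨c * (2 ^ d * B) * ((d : ℝ) + 1) ^ d, by positivity⟩, fun N hN => ?_⟩
  have hN' : (1 : ℝ) ≤ N := by exact_mod_cast hN
  have hN0 : (0 : ℝ) < 2 * (N : ℝ) := by linarith
  set b : ℕ → ℝ := fun i => 2 * (N : ℝ) * (1 - i * (1 / (2 * (d : ℝ)))) with hb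
  have hfun : (fun k : ℕ => cutoff d d ((k : ℝ) / (2 * N))) =
      (c / (2 * (N : ℝ)) ^ d) • ∑ i ∈ Finset.range (d + 1),
        ((-1) ^ i * (d.choose i : ℝ)) • fun k : ℕ => truncPow d (b i - k) := by
    funext k
    rw [cutoff_div_eq_sum hN]
    simp [hc, hb]
  have hdiff : ∀ k, |(fwdDiff 1)^[d + 1] (fun k : ℕ => cutoff d d ((k : ℝ) / (2 * N))) k| ≤
      c / (2 * (N : ℝ)) ^ d * ∑ i ∈ Finset.range (d + 1), (d.choose i : ℝ) *
        |(fwdDiff 1)^[d + 1] (fun k : ℕ => truncPow d (b i - k)) k| := by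
    intro k
    rw [hfun, fwdDiff_iter_const_smul, fwdDiff_iter_finsetSum, Pi.smul_apply, smul_eq_mul, abs_mul,
      abs_of_nonneg (by positivity), Finset.sum_apply]
    gcongr
    refine (Finset.abs_sum_le_sum_abs _ _).trans (Finset.sum_le_sum fun i _ => ?_)
    rw [fwdDiff_iter_const_smul, Pi.smul_apply, smul_eq_mul, abs_mul, abs_mul, abs_pow, abs_neg,
      abs_one, one_pow, one_mul, Nat.abs_cast]
  have hchoose : ∀ k ∈ Finset.range (2 * N + 1),
      ((d + k).choose d : ℝ) ≤ ((d : ℝ) + 1) ^ d * (2 * (N : ℝ)) ^ d := by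
    intro k hk
    have hk : (k : ℝ) ≤ 2 * N := by
      have : k ≤ 2 * N := by simpa [Nat.lt_succ_iff] using hk
      exact_mod_cast this
    have h1 : ((d + k).choose d : ℝ) ≤ ((d : ℝ) + k) ^ d := by
      exact_mod_cast Nat.choose_le_pow (d + k) d
    refine h1.trans ?_
    rw [← mul_pow]
    have : (0 : ℝ) ≤ d := by positivity
    gcongr
    nlinarith
  have hchsum : (∑ j ∈ Finset.range (d + 1), (d.choose j : ℝ)) = 2 ^ d := by
    exact_mod_cast Nat.sum_range_choose d
  change _ ≤ c * (2 ^ d * B) * ((d : ℝ) + 1) ^ d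
  calc ∑ k ∈ Finset.range (2 * N + 1),
        |(fwdDiff 1)^[d + 1] (fun k : ℕ => cutoff d d ((k : ℝ) / (2 * N))) k| *
          ((d + k).choose d : ℝ)
      ≤ ∑ k ∈ Finset.range (2 * N + 1), (c / (2 * (N : ℝ)) ^ d *
          ∑ i ∈ Finset.range (d + 1), (d.choose i : ℝ) *
            |(fwdDiff 1)^[d + 1] (fun k : ℕ => truncPow d (b i - k)) k|) *
              (((d : ℝ) + 1) ^ d * (2 * (N : ℝ)) ^ d) := by
        refine Finset.sum_le_sum fun k hk => ?_
        exact mul_le_mul (hdiff k) (hchoose k hk) (by positivity)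
          ((abs_nonneg _).trans (hdiff k))
    _ = c * ((d : ℝ) + 1) ^ d * ∑ i ∈ Finset.range (d + 1), (d.choose i : ℝ) *
          ∑ k ∈ Finset.range (2 * N + 1),
            |(fwdDiff 1)^[d + 1] (fun k : ℕ => truncPow d (b i - k)) k| := by
        rw [← Finset.sum_mul, ← Finset.mul_sum, Finset.sum_comm]
        simp only [← Finset.mul_sum]
        field_simp
    _ ≤ c * ((d : ℝ) + 1) ^ d * ∑ i ∈ Finset.range (d + 1), (d.choose i : ℝ) * B := by
        gcongr with i _
        exact sum_abs_fwdDiff_iter_truncPow_le hd (b i) _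
    _ = c * (2 ^ d * B) * ((d : ℝ) + 1) ^ d := by
        rw [← Finset.sum_mul, hchsum]
        ring

/-! ### The Green identity for homogeneous functions -/

section Green

variable {E : Type*} [NormedAddCommGroup E] [InnerProductSpace ℝ E]

theorem iteratedFDeriv_two_eq_fderiv {F : Type*} [NormedAddCommGroup F] [NormedSpace ℝ F]
    {f : E → F} {x : E} (hf : ContDiffAt ℝ 2 f x) (v : E) :
    iteratedFDeriv ℝ 2 f x ![v, v] = fderiv ℝ (fun y => fderiv ℝ f y v) x v := by
  have h : DifferentiableAt ℝ (fderiv ℝ f) x :=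
    (hf.fderiv_right (m := 1) (by norm_num)).differentiableAt (by norm_num)
  rw [iteratedFDeriv_two_apply, fderiv_clm_apply h (by fun_prop)]
  simp

theorem contDiffAt_fderiv_apply {F : Type*} [NormedAddCommGroup F] [NormedSpace ℝ F]
    {f : E → F} {x : E} (hf : ContDiffAt ℝ 2 f x) (v : E) :
    ContDiffAt ℝ 1 (fun y => fderiv ℝ f y v) x :=
  (hf.fderiv_right (m := 1) (by norm_num)).clm_apply contDiffAt_const

/-- Euler's relation in degree 0. -/
theorem fderiv_apply_self_of_homogeneous {f : E → ℂ} (hom : ∀ c : ℝ, 0 < c → ∀ x, f (c • x) = f x)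
    {x : E} (hf : DifferentiableAt ℝ f x) : fderiv ℝ f x x = 0 := by
  have h1 : HasDerivAt (fun c : ℝ => f (c • x)) (fderiv ℝ f x x) 1 := by
    have hx : HasDerivAt (fun c : ℝ => c • x) ((1 : ℝ) • x) 1 := (hasDerivAt_id 1).smul_const x
    rw [one_smul] at hx
    have hf' : HasFDerivAt f (fderiv ℝ f x) ((1 : ℝ) • x) := by
      rw [one_smul]
      exact hf.hasFDerivAt
    exact hf'.comp_hasDerivAt 1 hx
  have h2 : HasDerivAt (fun c : ℝ => f (c • x)) 0 1 := by
    refine (hasDerivAt_const (1 : ℝ) (f x)).congr_of_eventuallyEq ?_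
    filter_upwards [lt_mem_nhds (zero_lt_one (α := ℝ))] with c hc
    exact hom c hc x
  exact h1.unique h2

variable [FiniteDimensional ℝ E]

theorem laplacian_eq_sum_fderiv {F : Type*} [NormedAddCommGroup F] [NormedSpace ℝ F]
    {f : E → F} {x : E} (hf : ContDiffAt ℝ 2 f x) {ι : Type*} [Fintype ι]
    (b : OrthonormalBasis ι ℝ E) :
    Laplacian.laplacian f x = ∑ i, fderiv ℝ (fun y => fderiv ℝ f y (b i)) x (b i) := by
  rw [InnerProductSpace.laplacian_eq_iteratedFDeriv_orthonormalBasis f b]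
  exact Finset.sum_congr rfl fun i _ => iteratedFDeriv_two_eq_fderiv hf (b i)

theorem laplacian_smul_of_homogeneous {f : E → ℂ} (hom : ∀ c : ℝ, 0 < c → ∀ x, f (c • x) = f x)
    {c : ℝ} (hc : 0 < c) (x : E) :
    Laplacian.laplacian f x = (c ^ 2 : ℝ) • Laplacian.laplacian f (c • x) := by
  have h0 : f = fun y => f (c • y) := funext fun y => (hom c hc y).symm
  have h1 : ∀ y, fderiv ℝ f y = c • fderiv ℝ f (c • y) := fun y => by
    conv_lhs => rw [h0, fderiv_comp_smul]
  have h2 : fderiv ℝ (fderiv ℝ f) x = (c ^ 2 : ℝ) • fderiv ℝ (fderiv ℝ f) (c • x) := by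
    have h3 : fderiv ℝ f = c • fun y => fderiv ℝ f (c • y) := funext h1
    conv_lhs => rw [h3]
    let _ := invertibleOfNonzero hc.ne'
    have h4 := fderiv_const_smul_of_invertible (𝕜 := ℝ) (f := fun y => fderiv ℝ f (c • y))
      (x := x) c
    rw [h4, fderiv_comp_smul, smul_smul, sq]
  rw [InnerProductSpace.laplacian_eq_iteratedFDeriv_stdOrthonormalBasis]
  simp only [iteratedFDeriv_two_apply, h2, Finset.smul_sum]
  rfl

variable [MeasurableSpace E] [BorelSpace E]

theorem integral_fderiv_eq_zero (μ : Measure E) [μ.IsAddHaarMeasure] {H : E → ℂ}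
    (hH : ContDiff ℝ 1 H) (hs : HasCompactSupport H) (v : E) : ∫ x, fderiv ℝ H x v ∂μ = 0 := by
  have hc : Continuous fun x => fderiv ℝ H x v :=
    (hH.continuous_fderiv (by norm_num)).clm_apply continuous_const
  have hi : Integrable (fun x => fderiv ℝ H x v) μ :=
    hc.integrable_of_hasCompactSupport (hs.fderiv_apply (𝕜 := ℝ) v)
  have := integral_mul_fderiv_eq_neg_fderiv_mul_of_integrable (μ := μ) (f := fun _ => (1 : ℂ))
    (g := H) (v := v) (by simp) (by simpa using hi)
    (by simpa using hH.continuous.integrable_of_hasCompactSupport hs)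
    (fun x _ => by fun_prop) (fun x _ => (hH.differentiable (by norm_num)).differentiableAt)
  simpa using this

/-- The Green identity for functions that are constant along rays, localized by a radial cutoff
vanishing near the origin. -/
theorem integral_radial_mul_laplacian_sub (μ : Measure E) [μ.IsAddHaarMeasure] {F G : E → ℂ}
    (hF : ∀ x ≠ 0, ContDiffAt ℝ 2 F x) (hG : ∀ x ≠ 0, ContDiffAt ℝ 2 G x)
    (hF' : ∀ c : ℝ, 0 < c → ∀ x, F (c • x) = F x) (hG' : ∀ c : ℝ, 0 < c → ∀ x, G (c • x) = G x)
    {η : ℝ → ℝ} (hη : ContDiff ℝ 2 η) (hηs : HasCompactSupport η)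
    (hη0 : ∀ᶠ s in nhds 0, η s = 0) :
    ∫ x, (η (‖x‖ ^ 2) : ℂ) *
      (G x * Laplacian.laplacian F x - F x * Laplacian.laplacian G x) ∂μ = 0 := by
  set b := stdOrthonormalBasis ℝ E with hb
  set φ : E → ℂ := fun x => (η (‖x‖ ^ 2) : ℂ) with hφ
  have hφc : ContDiff ℝ 2 φ :=
    Complex.ofRealCLM.contDiff.comp (hη.comp (contDiff_norm_sq ℝ))
  have hφ0 : ∀ᶠ x in nhds (0 : E), φ x = 0 := by
    have : Filter.Tendsto (fun x : E => ‖x‖ ^ 2) (nhds 0) (nhds 0) := by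
      have h : Continuous fun x : E => ‖x‖ ^ 2 := by fun_prop
      simpa using h.tendsto 0
    filter_upwards [this.eventually hη0] with x hx
    simp [hφ, hx]
  have hφs : HasCompactSupport φ := by
    obtain ⟨R, hR⟩ := hηs.isCompact.isBounded.subset_closedBall 0
    refine HasCompactSupport.intro (isCompact_closedBall (0 : E) (Real.sqrt (max R 0))) ?_
    intro x hx
    simp only [hφ]
    rw [Complex.ofReal_eq_zero]
    by_contra h
    have h1 := hR (subset_tsupport η (Function.mem_support.2 h))
    rw [mem_closedBall_zero_iff, Real.norm_eq_abs, abs_of_nonneg (by positivity)] at h1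
    apply hx
    rw [mem_closedBall_zero_iff]
    exact Real.le_sqrt_of_sq_le (h1.trans (le_max_left _ _))
  have hφd : ∀ x v, fderiv ℝ φ x v = ((2 * deriv η (‖x‖ ^ 2) * inner ℝ x v : ℝ) : ℂ) := by
    intro x v
    have h1 : HasFDerivAt (fun x : E => ‖x‖ ^ 2) (2 • innerSL ℝ x) x :=
      (hasStrictFDerivAt_norm_sq x).hasFDerivAt
    have h2 : HasDerivAt η (deriv η (‖x‖ ^ 2)) (‖x‖ ^ 2) :=
      (hη.differentiable (by norm_num)).differentiableAt.hasDerivAt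
    have h3 := Complex.ofRealCLM.hasFDerivAt.comp x (h2.comp_hasFDerivAt x h1)
    have h4 : fderiv ℝ φ x = _ := h3.fderiv
    rw [h4]
    simp
    ring
  -- The component along `v` of the field φ (G ∇F - F ∇G). Its divergence is the integrand: the
  -- cross terms G ∇F · ∇G cancel, and the terms with ∇φ vanish because ∇φ is radial.
  set H : E → E → ℂ := fun v x => φ x * (G x * fderiv ℝ F x v - F x * fderiv ℝ G x v) with hH
  have hH0 : ∀ v, ∀ᶠ x in nhds (0 : E), H v x = 0 := fun v => by
    filter_upwards [hφ0] with x hx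
    simp [hH, hx]
  have hHc : ∀ v, ContDiff ℝ 1 (H v) := by
    intro v
    rw [contDiff_iff_contDiffAt]
    intro x
    by_cases hx : x = 0
    · subst hx
      exact (contDiffAt_const (c := (0 : ℂ))).congr_of_eventuallyEq (hH0 v)
    · exact (hφc.contDiffAt.of_le (by norm_num)).mul
        ((((hG x hx).of_le (by norm_num)).mul (contDiffAt_fderiv_apply (hF x hx) v)).sub
          (((hF x hx).of_le (by norm_num)).mul (contDiffAt_fderiv_apply (hG x hx) v)))
  have hHs : ∀ v, HasCompactSupport (H v) := fun v => hφs.mul_right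
  have key : ∀ x, φ x * (G x * Laplacian.laplacian F x - F x * Laplacian.laplacian G x) =
      ∑ i, fderiv ℝ (H (b i)) x (b i) := by
    intro x
    by_cases hx : x = 0
    · subst hx
      rw [hφ0.self_of_nhds, zero_mul, Finset.sum_eq_zero]
      intro i _
      have : H (b i) =ᶠ[nhds 0] fun _ => (0 : ℂ) := hH0 _
      rw [this.fderiv_eq]
      simp
    · have hFd : DifferentiableAt ℝ F x := (hF x hx).differentiableAt (by norm_num)
      have hGd : DifferentiableAt ℝ G x := (hG x hx).differentiableAt (by norm_num)
      have hφx : DifferentiableAt ℝ φ x := (hφc.differentiable (by norm_num)).differentiableAt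
      have hder : ∀ v, fderiv ℝ (H v) x v =
          fderiv ℝ φ x v * (G x * fderiv ℝ F x v - F x * fderiv ℝ G x v) +
            φ x * (G x * fderiv ℝ (fun y => fderiv ℝ F y v) x v -
              F x * fderiv ℝ (fun y => fderiv ℝ G y v) x v) := by
        intro v
        have hF2 : DifferentiableAt ℝ (fun y => fderiv ℝ F y v) x :=
          (contDiffAt_fderiv_apply (hF x hx) v).differentiableAt (by norm_num)
        have hG2 : DifferentiableAt ℝ (fun y => fderiv ℝ G y v) x :=
          (contDiffAt_fderiv_apply (hG x hx) v).differentiableAt (by norm_num)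
        have h := hφx.hasFDerivAt.mul ((hGd.hasFDerivAt.mul hF2.hasFDerivAt).sub
          (hFd.hasFDerivAt.mul hG2.hasFDerivAt))
        have h' : fderiv ℝ (H v) x = _ := h.fderiv
        rw [h']
        simp
        ring
      -- ∇φ is a multiple of x, so the sum is a multiple of the radial derivative of `f`.
      have hsum : ∀ {f : E → ℂ}, fderiv ℝ f x x = 0 →
          ∑ i, fderiv ℝ φ x (b i) * fderiv ℝ f x (b i) = 0 := by
        intro f hf
        have h1 : ∀ i, fderiv ℝ φ x (b i) * fderiv ℝ f x (b i) =
            ((2 * deriv η (‖x‖ ^ 2) : ℝ) : ℂ) * fderiv ℝ f x (inner ℝ (b i) x • b i) := by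
          intro i
          rw [hφd, map_smul, real_inner_comm, Complex.real_smul]
          push_cast
          ring
        rw [Finset.sum_congr rfl fun i _ => h1 i, ← Finset.mul_sum, ← map_sum, b.sum_repr' x, hf,
          mul_zero]
      have hF0 := hsum (fderiv_apply_self_of_homogeneous hF' hFd)
      have hG0 := hsum (fderiv_apply_self_of_homogeneous hG' hGd)
      rw [laplacian_eq_sum_fderiv (hF x hx) b, laplacian_eq_sum_fderiv (hG x hx) b,
        Finset.sum_congr rfl fun i _ => hder (b i), Finset.sum_add_distrib]
      have h5 : ∑ i, fderiv ℝ φ x (b i) * (G x * fderiv ℝ F x (b i) - F x * fderiv ℝ G x (b i)) =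
          G x * ∑ i, fderiv ℝ φ x (b i) * fderiv ℝ F x (b i) -
            F x * ∑ i, fderiv ℝ φ x (b i) * fderiv ℝ G x (b i) := by
        rw [Finset.mul_sum, Finset.mul_sum, ← Finset.sum_sub_distrib]
        exact Finset.sum_congr rfl fun i _ => by ring
      rw [h5, hF0, hG0, mul_zero, mul_zero, sub_zero, zero_add, ← Finset.mul_sum,
        Finset.sum_sub_distrib, Finset.mul_sum, Finset.mul_sum]
  rw [integral_congr_ae (Filter.Eventually.of_forall key), integral_finsetSum]
  · exact Finset.sum_eq_zero fun i _ => integral_fderiv_eq_zero μ (hHc _) (hHs _) _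
  · intro i _
    have hc : Continuous fun x => fderiv ℝ (H (b i)) x (b i) :=
      ((hHc (b i)).continuous_fderiv (by norm_num)).clm_apply continuous_const
    exact hc.integrable_of_hasCompactSupport ((hHs _).fderiv_apply (𝕜 := ℝ) _)

end Green

/-! ### Orthogonality of the eigenspaces -/

theorem norm_coe_csphere {n : ℕ} (x : CSphere n) : ‖(x : EuclideanSpace ℂ (Fin n))‖ = 1 :=
  mem_sphere_zero_iff_norm.1 x.2

theorem coe_csphere_ne_zero {n : ℕ} (x : CSphere n) : (x : EuclideanSpace ℂ (Fin n)) ≠ 0 := by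
  rw [← norm_ne_zero_iff, norm_coe_csphere]
  exact one_ne_zero

theorem radialExt_smul_of_pos {n : ℕ} (f : CSphere n → ℂ) (c : ℝ) (hc : 0 < c)
    (x : EuclideanSpace ℂ (Fin n)) : radialExt f (c • x) = radialExt f x := by
  by_cases h : x = 0
  · simp [h]
  · have h' : c • x ≠ 0 := smul_ne_zero hc.ne' h
    simp only [radialExt, dif_neg h, dif_neg h']
    congr 2
    rw [norm_smul, Real.norm_of_nonneg hc.le, smul_smul]
    congr 1
    field_simp

theorem radialExt_coe {n : ℕ} (f : CSphere n → ℂ) (x : CSphere n) : radialExt f x = f x := by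
  simp only [radialExt, dif_neg (coe_csphere_ne_zero x)]
  congr 2
  simp

theorem radialExt_mul {n : ℕ} (f g : CSphere n → ℂ) (x : EuclideanSpace ℂ (Fin n)) :
    radialExt (f * g) x = radialExt f x * radialExt g x := by
  by_cases h : x = 0 <;> simp [radialExt, h]

theorem IsSmooth.contDiffAt {n : ℕ} {f : CSphere n → ℂ} (hf : IsSmooth f)
    {x : EuclideanSpace ℂ (Fin n)} (hx : x ≠ 0) : ContDiffAt ℝ 2 (radialExt f) x :=
  (ContDiffOn.contDiffAt hf (isOpen_compl_singleton.mem_nhds hx)).of_le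
    (WithTop.coe_le_coe.2 le_top)

theorem IsSmooth.continuous {n : ℕ} {f : CSphere n → ℂ} (hf : IsSmooth f) : Continuous f := by
  have h : f = radialExt f ∘ Subtype.val := funext fun x => (radialExt_coe f x).symm
  rw [h, continuous_iff_continuousAt]
  intro x
  exact (hf.contDiffAt (coe_csphere_ne_zero x)).continuousAt.comp
    continuous_subtype_val.continuousAt

/-- The extension has degree 0 and its Laplacian degree -2, so the equation on the sphere propagates
along rays with the factor ‖x‖². -/
theorem laplacian_radialExt_of_mem_eigenspace {n k : ℕ} {f : CSphere n → ℂ}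
    (hf : f ∈ eigenspace n k) {x : EuclideanSpace ℂ (Fin n)} (hx : x ≠ 0) :
    ((‖x‖ ^ 2 : ℝ) : ℂ) * Laplacian.laplacian (radialExt f) x =
      -((theta n k : ℂ) * radialExt f x) := by
  have hpos : 0 < ‖x‖ := norm_pos_iff.2 hx
  let y : CSphere n := ⟨‖x‖⁻¹ • x, by
    rw [mem_sphere_zero_iff_norm, norm_smul, norm_inv, norm_norm, inv_mul_cancel₀ hpos.ne']⟩
  have h1 := hf.2 y
  have h2 := laplacian_smul_of_homogeneous (radialExt_smul_of_pos f) (inv_pos.2 hpos) x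
  have h3 : radialExt f x = f y := by simp only [radialExt, dif_neg hx, y]
  rw [laplaceBeltrami] at h1
  change -(Laplacian.laplacian (radialExt f) (‖x‖⁻¹ • x)) = _ at h1
  rw [h2, h3, ← h1, Complex.real_smul, ← mul_assoc, ← Complex.ofReal_mul]
  rw [show ‖x‖ ^ 2 * ‖x‖⁻¹ ^ 2 = 1 by field_simp]
  simp

theorem nontrivial_euclideanSpace {n : ℕ} (hn : 1 ≤ n) : Nontrivial (EuclideanSpace ℂ (Fin n)) := by
  have : Nonempty (Fin n) := ⟨⟨0, hn⟩⟩
  infer_instance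

/-- Integration in polar coordinates of a product of a radial and a spherical factor. -/
theorem integral_radial_mul_radialExt {n : ℕ} (hn : 1 ≤ n) (w : ℝ → ℂ) (f : CSphere n → ℂ) :
    ∫ x : EuclideanSpace ℂ (Fin n), w ‖x‖ * radialExt f x =
      (∫ x, f x ∂(volume : Measure (EuclideanSpace ℂ (Fin n))).toSphere) *
        ∫ r : Set.Ioi (0 : ℝ), w r
          ∂(Measure.volumeIoiPow (Module.finrank ℝ (EuclideanSpace ℂ (Fin n)) - 1)) := by
  have := nontrivial_euclideanSpace hn
  set μ : Measure (EuclideanSpace ℂ (Fin n)) := volume with hμ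
  calc ∫ x, w ‖x‖ * radialExt f x ∂μ
      = ∫ x : ({(0)}ᶜ : Set (EuclideanSpace ℂ (Fin n))), w ‖x.1‖ * radialExt f x.1
          ∂(μ.comap (↑)) := by
        rw [integral_subtype_comap (measurableSet_singleton _).compl
          fun x => w ‖x‖ * radialExt f x, restrict_compl_singleton]
    _ = ∫ z : CSphere n × Set.Ioi (0 : ℝ), f z.1 * w z.2
          ∂μ.toSphere.prod (.volumeIoiPow (Module.finrank ℝ (EuclideanSpace ℂ (Fin n)) - 1)) := by
        rw [← μ.measurePreserving_homeomorphUnitSphereProd.integral_comp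
          (Homeomorph.measurableEmbedding _)]
        refine integral_congr_ae (Filter.Eventually.of_forall fun x => ?_)
        have hx : (x : EuclideanSpace ℂ (Fin n)) ≠ 0 := x.2
        simp only [homeomorphUnitSphereProd_apply_snd_coe]
        rw [mul_comm]
        congr 1
        simp only [radialExt, dif_neg hx]
        congr 1
        ext1
        simp
    _ = _ := integral_prod_mul f fun r : Set.Ioi (0 : ℝ) => w r

theorem theta_injective {n : ℕ} (hn : 1 ≤ n) : Function.Injective (theta n) := by
  refine StrictMono.injective (strictMono_nat_of_lt_succ fun k => ?_)
  unfold theta dim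
  rw [Nat.cast_sub (by omega)]
  push_cast
  have h1 : (1 : ℝ) ≤ n := by exact_mod_cast hn
  have h2 : (0 : ℝ) ≤ k := by positivity
  nlinarith

theorem isProbabilityMeasure_nu {n : ℕ} (hn : 1 ≤ n) : IsProbabilityMeasure (nu n) := by
  have := nontrivial_euclideanSpace hn
  have h0 : (volume : Measure (EuclideanSpace ℂ (Fin n))).toSphere Set.univ ≠ 0 := by
    rw [Ne, Measure.measure_univ_eq_zero]
    exact Measure.toSphere_ne_zero _
  refine ⟨?_⟩
  rw [nu]
  simp only [Measure.smul_apply, smul_eq_mul]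
  exact ENNReal.inv_mul_cancel h0 (measure_ne_top _ _)

/-- Eigenfunctions of the Laplace-Beltrami operator for different eigenvalues are orthogonal. -/
theorem integral_mul_eq_zero_of_mem_eigenspace {n : ℕ} (hn : 1 ≤ n) {j k : ℕ} (hjk : j ≠ k)
    {f g : CSphere n → ℂ} (hf : f ∈ eigenspace n j) (hg : g ∈ eigenspace n k) :
    ∫ x, f x * g x ∂(nu n) = 0 := by
  have := nontrivial_euclideanSpace hn
  -- A bump supported in [1, 3], away from the singularity of the extensions at 0. The extra factor
  -- `s` in `η` absorbs the ‖x‖² of the eigenvalue equation.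
  let ψ : ContDiffBump (2 : ℝ) := ⟨1 / 2, 1, by norm_num, by norm_num⟩
  set η : ℝ → ℝ := fun s => s * ψ s with hη
  have hψs : ∀ s : ℝ, s ≤ 1 → ψ s = 0 := fun s hs => by
    refine ψ.zero_of_le_dist ?_
    change (1 : ℝ) ≤ dist s 2
    rw [Real.dist_eq, abs_sub_comm]
    exact le_trans (by linarith) (le_abs_self _)
  have hgreen := integral_radial_mul_laplacian_sub (volume : Measure (EuclideanSpace ℂ (Fin n)))
    (fun x hx => hf.1.contDiffAt hx) (fun x hx => hg.1.contDiffAt hx) (radialExt_smul_of_pos f)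
    (radialExt_smul_of_pos g) (η := η) (contDiff_id.mul ψ.contDiff)
    (ψ.hasCompactSupport.mul_left) (by
      filter_upwards [gt_mem_nhds (zero_lt_one (α := ℝ))] with s hs
      rw [hη]
      simp only
      rw [hψs s hs.le, mul_zero])
  have h_integrand : ∀ x : EuclideanSpace ℂ (Fin n), (η (‖x‖ ^ 2) : ℂ) *
      (radialExt g x * Laplacian.laplacian (radialExt f) x -
        radialExt f x * Laplacian.laplacian (radialExt g) x) =
      ((theta n k : ℂ) - theta n j) * ((ψ (‖x‖ ^ 2) : ℂ) * radialExt (f * g) x) := by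
    intro x
    by_cases hx : x = 0
    · have h0 : ψ (‖x‖ ^ 2) = 0 := hψs _ (by simp [hx])
      simp [hη, h0]
    · have h1 := laplacian_radialExt_of_mem_eigenspace hf hx
      have h2 := laplacian_radialExt_of_mem_eigenspace hg hx
      rw [radialExt_mul, hη]
      simp only
      rw [Complex.ofReal_mul]
      linear_combination (ψ (‖x‖ ^ 2) : ℂ) * (radialExt g x * h1 - radialExt f x * h2)
  rw [integral_congr_ae (Filter.Eventually.of_forall h_integrand), integral_const_mul,
    integral_radial_mul_radialExt hn (fun r => (ψ (r ^ 2) : ℂ)) (f * g)] at hgreen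
  -- The radial factor is nonzero: for the constant function 1 the polar formula gives the integral
  -- of ψ(‖x‖²), which is positive because ψ = 1 where ‖x‖² = 2.
  have hw : (∫ r : Set.Ioi (0 : ℝ), (ψ ((r : ℝ) ^ 2) : ℂ)
      ∂(Measure.volumeIoiPow (Module.finrank ℝ (EuclideanSpace ℂ (Fin n)) - 1))) ≠ 0 := by
    intro h0
    have h1 := integral_radial_mul_radialExt hn (fun r => (ψ (r ^ 2) : ℂ)) (n := n) (fun _ => 1)
    rw [h0, mul_zero] at h1
    have h2 : ∫ x : EuclideanSpace ℂ (Fin n), (ψ (‖x‖ ^ 2) : ℂ) * radialExt (fun _ => 1) x =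
        ((∫ x : EuclideanSpace ℂ (Fin n), ψ (‖x‖ ^ 2) : ℝ) : ℂ) := by
      rw [← integral_complex_ofReal]
      refine integral_congr_ae (Filter.Eventually.of_forall fun x => ?_)
      by_cases hx : x = 0
      · have : ψ (‖x‖ ^ 2) = 0 := hψs _ (by simp [hx])
        simp [this]
      · simp [radialExt, hx]
    rw [h2, Complex.ofReal_eq_zero] at h1
    obtain ⟨x, hx⟩ := exists_norm_eq (EuclideanSpace ℂ (Fin n)) (Real.sqrt_nonneg 2)
    have h3 : 0 < ∫ x : EuclideanSpace ℂ (Fin n), ψ (‖x‖ ^ 2) := by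
      refine Continuous.integral_pos_of_hasCompactSupport_nonneg_nonzero
        (ψ.continuous.comp (by fun_prop)) ?_ (fun x => ψ.nonneg) (x := x) ?_
      · refine HasCompactSupport.intro
          (isCompact_closedBall (0 : EuclideanSpace ℂ (Fin n)) 3) fun y hy => ?_
        refine ψ.zero_of_le_dist ?_
        change (1 : ℝ) ≤ dist _ 2
        rw [mem_closedBall_zero_iff, not_le] at hy
        rw [Real.dist_eq]
        exact le_trans (by nlinarith) (le_abs_self _)
      · rw [hx, Real.sq_sqrt (by norm_num)]
        rw [ψ.one_of_mem_closedBall (by simp [ψ])]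
        exact one_ne_zero
    exact h3.ne' h1
  have hθ : (theta n k : ℂ) - theta n j ≠ 0 := by
    rw [sub_ne_zero, Ne, Complex.ofReal_inj]
    exact fun h => hjk (theta_injective hn h).symm
  have h4 : ∫ x, (f * g) x ∂(volume : Measure (EuclideanSpace ℂ (Fin n))).toSphere = 0 := by
    rcases mul_eq_zero.1 hgreen with h | h
    · exact absurd h hθ
    · exact (mul_eq_zero.1 h).resolve_right hw
  rw [nu]
  simp only [integral_smul_measure]
  simp only [Pi.mul_apply] at h4
  rw [h4, smul_zero]

/-! ### Zonal eigenfunctions -/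

/-- Reduces a diagonal second derivative to one-variable calculus on the line through `x` in
direction `v`. -/
theorem iteratedFDeriv_two_eq_of_hasDerivAt {E F : Type*} [NormedAddCommGroup E] [NormedSpace ℝ E]
    [NormedAddCommGroup F] [NormedSpace ℝ F] {f : E → F} {x v : E} (hf : ContDiffAt ℝ 2 f x)
    {l : ℝ → F} {L : F} (h1 : ∀ᶠ s in nhds (0 : ℝ), HasDerivAt (fun s => f (x + s • v)) (l s) s)
    (h2 : HasDerivAt l L 0) : iteratedFDeriv ℝ 2 f x ![v, v] = L := by
  have hline : ∀ s : ℝ, HasDerivAt (fun s : ℝ => x + s • v) v s := fun s => by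
    simpa using ((hasDerivAt_id s).smul_const v).const_add x
  have hd : DifferentiableAt ℝ (fderiv ℝ f) x :=
    (hf.fderiv_right (m := 1) (by norm_num)).differentiableAt (by norm_num)
  have hev : ∀ᶠ s in nhds (0 : ℝ), l s = fderiv ℝ f (x + s • v) v := by
    have hcont : Filter.Tendsto (fun s : ℝ => x + s • v) (nhds 0) (nhds x) := by
      have := (hline 0).continuousAt.tendsto
      simpa using this
    have hdiff : ∀ᶠ y in nhds x, DifferentiableAt ℝ f y := by
      filter_upwards [(hf.of_le (by norm_num : (1 : WithTop ℕ∞) ≤ 2)).eventually (by simp)]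
        with y hy
      exact hy.differentiableAt (by norm_num)
    filter_upwards [h1, hcont.eventually hdiff] with s hs hs'
    exact hs.unique (hs'.hasFDerivAt.comp_hasDerivAt s (hline s))
  have h3 : HasDerivAt (fun s : ℝ => fderiv ℝ f (x + s • v) v) (fderiv ℝ (fderiv ℝ f) x v v) 0 := by
    have hd' : HasFDerivAt (fderiv ℝ f) (fderiv ℝ (fderiv ℝ f) x) (x + (0 : ℝ) • v) := by
      simpa using hd.hasFDerivAt
    have h4 := hd'.comp_hasDerivAt (0 : ℝ) (hline 0)
    simpa using h4.clm_apply (hasDerivAt_const (0 : ℝ) v)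
  rw [iteratedFDeriv_two_apply]
  exact h3.unique (h2.congr_of_eventuallyEq (hev.mono fun s hs => hs.symm))

/-- This quotient is ⟨e, y⟩ / ‖y‖ on the line y = x + s v for unit vectors x and v, with t, b, c the
inner products ⟨e, x⟩, ⟨e, v⟩, ⟨x, v⟩. -/
theorem hasDerivAt_div_sqrt {t b c s : ℝ} (hs : 0 < 1 + 2 * c * s + s ^ 2) :
    HasDerivAt (fun s : ℝ => (t + s * b) / Real.sqrt (1 + 2 * c * s + s ^ 2))
      (b / Real.sqrt (1 + 2 * c * s + s ^ 2) -
        (t + s * b) * (c + s) / Real.sqrt (1 + 2 * c * s + s ^ 2) ^ 3) s := by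
  have hR : HasDerivAt (fun s : ℝ => 1 + 2 * c * s + s ^ 2) (2 * c + 2 * s) s := by
    have h := (((hasDerivAt_id s).const_mul (2 * c)).const_add 1).add (hasDerivAt_pow 2 s)
    simp only [Nat.cast_ofNat, mul_one, Nat.add_one_sub_one, pow_one] at h
    exact h
  have hq := hR.sqrt hs.ne'
  have hl : HasDerivAt (fun s : ℝ => t + s * b) b s := by
    simpa using ((hasDerivAt_id s).mul_const b).const_add t
  have hpos := Real.sqrt_pos.2 hs
  convert! hl.div hq hpos.ne' using 1
  field_simp

theorem hasDerivAt_deriv_div_sqrt (t b c : ℝ) :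
    HasDerivAt (fun s : ℝ => b / Real.sqrt (1 + 2 * c * s + s ^ 2) -
        (t + s * b) * (c + s) / Real.sqrt (1 + 2 * c * s + s ^ 2) ^ 3)
      (-2 * b * c - t + 3 * t * c ^ 2) 0 := by
  have hR : HasDerivAt (fun s : ℝ => 1 + 2 * c * s + s ^ 2) (2 * c) 0 := by
    have h := (((hasDerivAt_id (0 : ℝ)).const_mul (2 * c)).const_add 1).add (hasDerivAt_pow 2 0)
    simp only [Nat.cast_ofNat, mul_one, Nat.add_one_sub_one, pow_one, mul_zero, add_zero] at h
    exact h
  have hq : HasDerivAt (fun s : ℝ => Real.sqrt (1 + 2 * c * s + s ^ 2)) c 0 := by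
    have := hR.sqrt (by norm_num)
    simpa using this
  have hl : HasDerivAt (fun s : ℝ => t + s * b) b 0 := by
    simpa using ((hasDerivAt_id (0 : ℝ)).mul_const b).const_add t
  have hm : HasDerivAt (fun s : ℝ => c + s) 1 0 := (hasDerivAt_id (0 : ℝ)).const_add c
  have h := ((hasDerivAt_const (0 : ℝ) b).div hq (by norm_num)).sub
    ((hl.mul hm).div (hq.pow 3) (by norm_num))
  convert! h using 1
  norm_num
  ring

section Zonal

variable {E : Type*} [NormedAddCommGroup E] [InnerProductSpace ℝ E]

theorem contDiffAt_zonal (p : Polynomial ℝ) (e : E) {x : E} (hx : x ≠ 0) {m : WithTop ℕ∞} :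
    ContDiffAt ℝ m (fun y : E => p.eval (inner ℝ e y / ‖y‖)) x := by
  have h1 : ContDiff ℝ m fun t : ℝ => p.eval t := by
    have := p.contDiff_aeval (𝕜 := ℝ) (n := m)
    simpa using this
  have h2 : ContDiffAt ℝ m (fun y : E => inner ℝ e y / ‖y‖) x :=
    (contDiffAt_const.inner ℝ contDiffAt_id).div (contDiffAt_norm ℝ hx) (norm_ne_zero_iff.2 hx)
  exact h1.contDiffAt.comp x h2

theorem iteratedFDeriv_two_zonal (p : Polynomial ℝ) {e x v : E} (hx : ‖x‖ = 1) (hv : ‖v‖ = 1) :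
    iteratedFDeriv ℝ 2 (fun y : E => p.eval (inner ℝ e y / ‖y‖)) x ![v, v] =
      (derivative (derivative p)).eval (inner ℝ e x) *
        (inner ℝ e v - inner ℝ e x * inner ℝ x v) ^ 2 +
      (derivative p).eval (inner ℝ e x) *
        (-2 * inner ℝ e v * inner ℝ x v - inner ℝ e x + 3 * inner ℝ e x * inner ℝ x v ^ 2) := by
  have hx0 : x ≠ 0 := by
    rw [← norm_ne_zero_iff, hx]
    exact one_ne_zero
  set t : ℝ := inner ℝ e x
  set b : ℝ := inner ℝ e v
  set c : ℝ := inner ℝ x v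
  set u : ℝ → ℝ := fun s => (t + s * b) / Real.sqrt (1 + 2 * c * s + s ^ 2) with hu
  set u' : ℝ → ℝ := fun s => b / Real.sqrt (1 + 2 * c * s + s ^ 2) -
    (t + s * b) * (c + s) / Real.sqrt (1 + 2 * c * s + s ^ 2) ^ 3 with hu'
  have hline : (fun s : ℝ => p.eval (inner ℝ e (x + s • v) / ‖x + s • v‖)) =
      fun s => p.eval (u s) := by
    funext s
    have h1 : inner ℝ e (x + s • v) = t + s * b := by
      rw [inner_add_right, inner_smul_right]
    have h2 : ‖x + s • v‖ = Real.sqrt (1 + 2 * c * s + s ^ 2) := by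
      rw [eq_comm, Real.sqrt_eq_iff_eq_sq _ (norm_nonneg _), norm_add_sq_real, inner_smul_right,
        norm_smul, hx, hv, Real.norm_eq_abs, mul_one, sq_abs]
      · ring
      · have h3 : c ^ 2 ≤ 1 := by
          have := abs_real_inner_le_norm x v
          rw [hx, hv, mul_one] at this
          exact (sq_le_one_iff_abs_le_one c).2 this
        nlinarith [sq_nonneg (s + c)]
    rw [h1, h2]
  have hu0 : u 0 = t := by simp [hu]
  have hu'0 : u' 0 = b - t * c := by simp [hu']
  refine iteratedFDeriv_two_eq_of_hasDerivAt (contDiffAt_zonal p e hx0)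
    (l := fun s => (derivative p).eval (u s) * u' s) ?_ ?_
  · have hpos : ∀ᶠ s in nhds (0 : ℝ), 0 < 1 + 2 * c * s + s ^ 2 := by
      have hc : Continuous fun s : ℝ => 1 + 2 * c * s + s ^ 2 := by fun_prop
      have := hc.tendsto 0
      exact this.eventually (lt_mem_nhds (by norm_num))
    filter_upwards [hpos] with s hs
    rw [hline]
    exact (p.hasDerivAt (u s)).comp s (hasDerivAt_div_sqrt hs)
  · have h1 : HasDerivAt u (u' 0) 0 := hasDerivAt_div_sqrt (by norm_num)
    have h2 : HasDerivAt u' (-2 * b * c - t + 3 * t * c ^ 2) 0 := hasDerivAt_deriv_div_sqrt t b c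
    have h3 := (((derivative p).hasDerivAt (u 0)).comp (0 : ℝ) h1).mul h2
    convert! h3 using 1
    simp only [Function.comp, hu0, hu'0]
    ring

/-- Sum the second derivatives over an orthonormal basis; Parseval turns the quadratic sums into 1,
1 and ⟨e, x⟩. The result is the Gegenbauer operator. -/
theorem laplacian_zonal [FiniteDimensional ℝ E] (p : Polynomial ℝ) {e x : E} (he : ‖e‖ = 1)
    (hx : ‖x‖ = 1) :
    Laplacian.laplacian (fun y : E => p.eval (inner ℝ e y / ‖y‖)) x =
      (1 - inner ℝ e x ^ 2) * (derivative (derivative p)).eval (inner ℝ e x) -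
        ((Module.finrank ℝ E : ℝ) - 1) * inner ℝ e x * (derivative p).eval (inner ℝ e x) := by
  set b := stdOrthonormalBasis ℝ E
  rw [InnerProductSpace.laplacian_eq_iteratedFDeriv_orthonormalBasis _ b]
  simp only [fun i => iteratedFDeriv_two_zonal p (e := e) hx (b.norm_eq_one i)]
  have h1 : ∑ i, inner ℝ e (b i) ^ 2 = (1 : ℝ) := by
    simpa [he, real_inner_comm] using b.sum_sq_inner_right e
  have h2 : ∑ i, inner ℝ x (b i) ^ 2 = (1 : ℝ) := by
    simpa [hx, real_inner_comm] using b.sum_sq_inner_right x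
  have h3 : ∑ i, inner ℝ e (b i) * inner ℝ x (b i) = inner ℝ e x := by
    simpa [real_inner_comm] using b.sum_inner_mul_inner e x
  set t : ℝ := inner ℝ e x
  set P₂ := (derivative (derivative p)).eval t
  set P₁ := (derivative p).eval t
  have h4 : ∀ i, P₂ * (inner ℝ e (b i) - t * inner ℝ x (b i)) ^ 2 +
      P₁ * (-2 * inner ℝ e (b i) * inner ℝ x (b i) - t + 3 * t * inner ℝ x (b i) ^ 2) =
      P₂ * inner ℝ e (b i) ^ 2 + (P₂ * t ^ 2 + 3 * t * P₁) * inner ℝ x (b i) ^ 2 -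
        (2 * P₂ * t + 2 * P₁) * (inner ℝ e (b i) * inner ℝ x (b i)) - P₁ * t := fun i => by ring
  rw [Finset.sum_congr rfl fun i _ => h4 i, Finset.sum_sub_distrib, Finset.sum_sub_distrib,
    Finset.sum_add_distrib, ← Finset.mul_sum, ← Finset.mul_sum, ← Finset.mul_sum, h1, h2, h3]
  simp
  ring

end Zonal

theorem re_herm {n : ℕ} (x e : CSphere n) :
    (herm x e).re = inner ℝ (e : EuclideanSpace ℂ (Fin n)) (x : EuclideanSpace ℂ (Fin n)) := by
  simp [herm, PiLp.inner_apply, Complex.inner]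

theorem finrank_real_euclideanSpace (n : ℕ) :
    Module.finrank ℝ (EuclideanSpace ℂ (Fin n)) = 2 * n := by
  rw [← Module.finrank_mul_finrank ℝ ℂ]
  simp

theorem radialExt_zonal {n : ℕ} (p : Polynomial ℝ) (e : CSphere n)
    {x : EuclideanSpace ℂ (Fin n)} (hx : x ≠ 0) :
    radialExt (fun x => ((p.eval (herm x e).re : ℝ) : ℂ)) x =
      Complex.ofRealCLM (p.eval (inner ℝ (e : EuclideanSpace ℂ (Fin n)) x / ‖x‖)) := by
  simp only [radialExt, dif_neg hx, re_herm, inner_smul_right]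
  rw [inv_mul_eq_div]
  rfl

/-- A polynomial solution of the Gegenbauer equation gives a zonal eigenfunction. -/
theorem zonal_mem_eigenspace {n k : ℕ} {p : Polynomial ℝ}
    (hp : ∀ t : ℝ, (1 - t ^ 2) * (derivative (derivative p)).eval t -
      (2 * (n : ℝ) - 1) * t * (derivative p).eval t + theta n k * p.eval t = 0) (e : CSphere n) :
    (fun x => ((p.eval (herm x e).re : ℝ) : ℂ)) ∈ eigenspace n k := by
  have hev : ∀ x : EuclideanSpace ℂ (Fin n), x ≠ 0 →
      radialExt (fun x => ((p.eval (herm x e).re : ℝ) : ℂ)) =ᶠ[nhds x]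
        Complex.ofRealCLM ∘
          fun y => p.eval (inner ℝ (e : EuclideanSpace ℂ (Fin n)) y / ‖y‖) := fun x hx => by
    filter_upwards [isOpen_compl_singleton.mem_nhds hx] with y hy
    exact radialExt_zonal p e hy
  refine ⟨fun x hx => ?_, fun x => ?_⟩
  · refine ContDiffAt.contDiffWithinAt ?_
    refine ContDiffAt.congr_of_eventuallyEq ?_ (hev x hx)
    exact Complex.ofRealCLM.contDiff.contDiffAt.comp x (contDiffAt_zonal p _ hx)
  · have hx := coe_csphere_ne_zero x
    rw [laplaceBeltrami, (InnerProductSpace.laplacian_congr_nhds (hev x hx)).self_of_nhds,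
      (contDiffAt_zonal p _ hx).laplacian_CLM_comp_left, Function.comp_apply,
      laplacian_zonal p (norm_coe_csphere e) (norm_coe_csphere x), finrank_real_euclideanSpace]
    simp only [re_herm]
    have := hp (inner ℝ (e : EuclideanSpace ℂ (Fin n)) (x : EuclideanSpace ℂ (Fin n)))
    rw [Complex.ofRealCLM_apply, ← Complex.ofReal_neg, ← Complex.ofReal_mul, Complex.ofReal_inj]
    push_cast
    linarith

theorem theta_eq {n : ℕ} (hn : 1 ≤ n) (k : ℕ) : theta n k = (k : ℝ) * (k + 2 * (n - 1 : ℕ)) := by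
  unfold theta dim
  rw [Nat.cast_sub (by omega), Nat.cast_sub (by omega)]
  push_cast
  ring

theorem zonalPoly_mem_eigenspace {n : ℕ} (hn : 1 ≤ n) (k : ℕ) (e : CSphere n) :
    (fun x => (((zonalPoly (n - 1) k).eval (herm x e).re : ℝ) : ℂ)) ∈ eigenspace n k := by
  refine zonal_mem_eigenspace (fun t => ?_) e
  have h := congrArg (Polynomial.eval t) (zonalPoly_ode (n - 1) k)
  have hn' : ((n - 1 : ℕ) : ℝ) = n - 1 := by rw [Nat.cast_sub hn, Nat.cast_one]
  simp only [Polynomial.eval_add, Polynomial.eval_sub, Polynomial.eval_mul, Polynomial.eval_pow,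
    Polynomial.eval_one, Polynomial.eval_X, Polynomial.eval_C, Polynomial.eval_zero] at h
  rw [theta_eq hn]
  rw [hn'] at h ⊢
  linear_combination h

/-! ### The reproducing property -/

theorem continuous_re_herm {n : ℕ} (e : CSphere n) :
    Continuous fun x : CSphere n => (herm x e).re := by
  simp only [re_herm]
  fun_prop

theorem continuous_zonal {n : ℕ} (p : Polynomial ℝ) (e : CSphere n) :
    Continuous fun x : CSphere n => p.eval (herm x e).re :=
  p.continuous.comp (continuous_re_herm e)

theorem continuous_cesaroKernel (lam m : ℕ) : Continuous (cesaroKernel lam m) := by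
  have h : cesaroKernel lam m = fun t => ∑ j ∈ Finset.range (m + 1),
      ((2 * lam + 1 + (m - j)).choose (2 * lam + 1) : ℝ) * (zonalPoly lam j).eval t :=
    funext fun t => cesaroKernel_eq_sum lam m t
  rw [h]
  fun_prop

theorem integrable_of_continuous {n : ℕ} (hn : 1 ≤ n) {F : Type*} [NormedAddCommGroup F]
    {f : CSphere n → F} (hf : Continuous f) : Integrable f (nu n) := by
  have := isProbabilityMeasure_nu hn
  exact hf.integrable_of_hasCompactSupport (HasCompactSupport.of_compactSpace f)

theorem re_herm_comm {n : ℕ} (x e : CSphere n) : (herm x e).re = (herm e x).re := by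
  rw [re_herm, re_herm, real_inner_comm]

theorem neg_one_le_re_herm {n : ℕ} (x e : CSphere n) : -1 ≤ (herm x e).re := by
  rw [re_herm]
  have h := abs_real_inner_le_norm (e : EuclideanSpace ℂ (Fin n)) (x : EuclideanSpace ℂ (Fin n))
  rw [norm_coe_csphere, norm_coe_csphere, mul_one] at h
  exact (abs_le.1 h).1

theorem dist_sq_eq {n : ℕ} (x e : CSphere n) : dist x e ^ 2 = 2 * (1 - (herm x e).re) := by
  rw [re_herm, Subtype.dist_eq, dist_eq_norm, norm_sub_sq_real, norm_coe_csphere, norm_coe_csphere,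
    real_inner_comm]
  ring

/-! ### Moments of the Cesàro kernels -/

theorem one_mem_eigenspace {n : ℕ} (e : CSphere n) :
    (fun _ : CSphere n => (1 : ℂ)) ∈ eigenspace n 0 := by
  have := zonal_mem_eigenspace (n := n) (k := 0) (p := 1) (fun t => by simp [theta]) e
  simpa using this

theorem re_herm_mem_eigenspace {n : ℕ} (hn : 1 ≤ n) (e : CSphere n) :
    (fun x : CSphere n => ((herm x e).re : ℂ)) ∈ eigenspace n 1 := by
  have := zonal_mem_eigenspace (n := n) (k := 1) (p := Polynomial.X) (fun t => by
    rw [theta_eq hn, Nat.cast_sub hn]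
    simp
    ring) e
  simpa using this

/-- The polynomial t² - 1/(2n) solves the Gegenbauer equation for `k = 2`, so it is orthogonal to
the constants. -/
theorem integral_re_herm_sq {n : ℕ} (hn : 1 ≤ n) (e : CSphere n) :
    ∫ x, ((herm x e).re : ℂ) * ((herm x e).re : ℂ) ∂(nu n) = 1 / (2 * n) := by
  have := isProbabilityMeasure_nu hn
  have hn0 : (n : ℝ) ≠ 0 := by
    have : (1 : ℝ) ≤ n := by exact_mod_cast hn
    positivity
  have h2 := zonal_mem_eigenspace (n := n) (k := 2)
    (p := Polynomial.X ^ 2 - Polynomial.C (1 / (2 * (n : ℝ)))) (fun t => by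
      rw [theta_eq hn, Nat.cast_sub hn]
      simp [Polynomial.derivative_pow]
      field_simp
      ring) e
  have h := integral_mul_eq_zero_of_mem_eigenspace hn (by norm_num : (2 : ℕ) ≠ 0) h2
    (one_mem_eigenspace e)
  have hsq : Continuous fun x : CSphere n => ((herm x e).re : ℂ) * ((herm x e).re : ℂ) := by
    have := continuous_re_herm e
    fun_prop
  have h3 : ∀ x : CSphere n, (((Polynomial.X ^ 2 - Polynomial.C (1 / (2 * (n : ℝ)))).eval
      (herm x e).re : ℝ) : ℂ) * 1 =
      ((herm x e).re : ℂ) * ((herm x e).re : ℂ) - 1 / (2 * n) := by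
    intro x
    simp
    ring
  simp only [h3] at h
  rw [integral_sub (integrable_of_continuous hn hsq) (integrable_const _), integral_const,
    probReal_univ, one_smul, sub_eq_zero] at h
  exact h

/-- By orthogonality only the k-th zonal term of the Cesàro sum survives. -/
theorem integral_mul_cesaroKernel {n : ℕ} (hn : 1 ≤ n) {k m : ℕ} (hkm : k ≤ m)
    {f : CSphere n → ℂ} (hf : f ∈ eigenspace n k) (e : CSphere n) :
    ∫ x, f x * (cesaroKernel (n - 1) m (herm x e).re : ℂ) ∂(nu n) =
      ((dim n + (m - k)).choose (dim n) : ℂ) *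
        ∫ x, f x * (((zonalPoly (n - 1) k).eval (herm x e).re : ℝ) : ℂ) ∂(nu n) := by
  have hd : 2 * (n - 1) + 1 = dim n := by
    unfold dim
    omega
  have h1 : ∀ x : CSphere n, f x * (cesaroKernel (n - 1) m (herm x e).re : ℂ) =
      ∑ j ∈ Finset.range (m + 1), ((dim n + (m - j)).choose (dim n) : ℂ) *
        (f x * (((zonalPoly (n - 1) j).eval (herm x e).re : ℝ) : ℂ)) := by
    intro x
    rw [cesaroKernel_eq_sum, hd]
    push_cast
    rw [Finset.mul_sum]
    exact Finset.sum_congr rfl fun j _ => by ring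
  simp only [h1]
  rw [integral_finsetSum]
  · simp only [integral_const_mul]
    rw [Finset.sum_eq_single_of_mem k (Finset.mem_range.2 (by omega))]
    intro j _ hj
    rw [integral_mul_eq_zero_of_mem_eigenspace hn hj.symm hf (zonalPoly_mem_eigenspace hn j e),
      mul_zero]
  · intro j _
    exact (integrable_of_continuous hn (hf.1.continuous.mul
      (Complex.continuous_ofReal.comp (continuous_zonal _ e)))).const_mul _

theorem integral_cesaroKernel {n : ℕ} (hn : 1 ≤ n) (m : ℕ) (e : CSphere n) :
    ∫ x, cesaroKernel (n - 1) m (herm x e).re ∂(nu n) = ((dim n + m).choose (dim n) : ℝ) := by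
  have := isProbabilityMeasure_nu hn
  have h := integral_mul_cesaroKernel hn (Nat.zero_le m) (one_mem_eigenspace e) e
  simp only [zonalPoly_zero, Polynomial.eval_one, Complex.ofReal_one, one_mul, mul_one,
    integral_const, probReal_univ, one_smul, Nat.sub_zero] at h
  rw [integral_complex_ofReal] at h
  exact_mod_cast h

/-- Re ⟨x, e⟩ lies in H_1 and Z_1(t) = 2n t, so the factor 2n cancels the second moment 1/(2n).
Against the total mass of the kernel of index `m + 1`, this measures how far it is from
concentration at `e`. -/
theorem integral_re_herm_mul_cesaroKernel {n : ℕ} (hn : 1 ≤ n) (m : ℕ) (e : CSphere n) :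
    ∫ x, (herm x e).re * cesaroKernel (n - 1) (m + 1) (herm x e).re ∂(nu n) =
      ((dim n + m).choose (dim n) : ℝ) := by
  have hn0 : (n : ℂ) ≠ 0 := by
    have : n ≠ 0 := by omega
    exact_mod_cast this
  have h := integral_mul_cesaroKernel hn (Nat.le_add_left 1 m) (re_herm_mem_eigenspace hn e) e
  have h1 : ∀ x : CSphere n,
      ((herm x e).re : ℂ) * (((zonalPoly (n - 1) 1).eval (herm x e).re : ℝ) : ℂ) =
        (2 * n : ℂ) * (((herm x e).re : ℂ) * ((herm x e).re : ℂ)) := by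
    intro x
    rw [zonalPoly_one, Nat.cast_sub hn]
    simp
    ring
  simp only [h1] at h
  rw [integral_const_mul, integral_re_herm_sq hn, Nat.add_sub_cancel] at h
  simp only [← Complex.ofReal_mul] at h
  rw [integral_complex_ofReal] at h
  have h2 : (2 * n : ℂ) * (1 / (2 * n)) = 1 := by field_simp
  rw [h2, mul_one] at h
  exact_mod_cast h

/-- Korovkin's estimate: 1 - Re ⟨x, e⟩ is half the squared distance, hence at least δ²/2 where
continuity gives nothing, and K = 2B/δ² makes it dominate the global bound B. -/
theorem exists_norm_sub_le {n : ℕ} {f : CSphere n → ℂ} (hf : Continuous f) (e : CSphere n) {ε : ℝ}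
    (hε : 0 < ε) : ∃ K : ℝ, ∀ x, ‖f x - f e‖ ≤ ε + K * (1 - (herm x e).re) := by
  obtain ⟨δ, hδ, hδ'⟩ := Metric.continuous_iff.1 hf e ε hε
  obtain ⟨B, hB⟩ := isCompact_univ.exists_bound_of_continuousOn (f := fun x => f x - f e)
    (hf.sub continuous_const).continuousOn
  have hB0 : 0 ≤ B := (norm_nonneg _).trans (hB e (Set.mem_univ e))
  refine ⟨2 * B / δ ^ 2, fun x => ?_⟩
  have h1 : 1 - (herm x e).re = dist x e ^ 2 / 2 := by rw [dist_sq_eq]; ring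
  rw [h1]
  by_cases hx : dist x e < δ
  · have := hδ' x hx
    rw [dist_eq_norm] at this
    have h2 : 0 ≤ 2 * B / δ ^ 2 * (dist x e ^ 2 / 2) := by positivity
    linarith
  · have h2 : B ≤ 2 * B / δ ^ 2 * (dist x e ^ 2 / 2) := by
      have h3 : δ ^ 2 ≤ dist x e ^ 2 := by
        have := not_lt.1 hx
        gcongr
      rw [show 2 * B / δ ^ 2 * (dist x e ^ 2 / 2) = B * (dist x e ^ 2 / δ ^ 2) by ring]
      exact le_mul_of_one_le_right hB0 ((one_le_div (by positivity)).2 h3)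
    linarith [hB x (Set.mem_univ x)]

/-- Consecutive binomials have ratio 1 - d / (i + d + 1), and the general ratio is a product of k
such ratios. -/
theorem tendsto_choose_div_choose (d k : ℕ) :
    Filter.Tendsto (fun i : ℕ => ((d + i).choose d : ℝ) / ((d + (i + k)).choose d : ℝ))
      Filter.atTop (nhds 1) := by
  have hpos : ∀ i : ℕ, ((d + i).choose d : ℝ) ≠ 0 := fun i => by
    have : 0 < (d + i).choose d := Nat.choose_pos (by omega)
    positivity
  have h1 : Filter.Tendsto (fun i : ℕ => ((d + i).choose d : ℝ) / ((d + (i + 1)).choose d : ℝ))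
      Filter.atTop (nhds 1) := by
    have h2 : ∀ i : ℕ, ((d + i).choose d : ℝ) / ((d + (i + 1)).choose d : ℝ) =
        1 - (d : ℝ) / ((i + (d + 1) : ℕ) : ℝ) := by
      intro i
      have h3 := Nat.add_one_mul_choose_eq (d + i) i
      rw [← Nat.choose_symm_add,
        ← Nat.choose_symm_of_eq_add (show d + i + 1 = d + (i + 1) by ring)] at h3
      have h4 : ((d : ℝ) + i + 1) * ((d + i).choose d : ℝ) =
          ((d + (i + 1)).choose d : ℝ) * (i + 1) := by exact_mod_cast h3
      have h5 := hpos (i + 1)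
      push_cast
      have h6 : ((i : ℝ) + (d + 1)) ≠ 0 := by positivity
      field_simp
      linear_combination h4
    simp only [h2]
    have h7 : Filter.Tendsto (fun i : ℕ => (d : ℝ) / ((i + (d + 1) : ℕ) : ℝ)) Filter.atTop
        (nhds 0) :=
      (tendsto_const_div_atTop_nhds_zero_nat (d : ℝ)).comp (Filter.tendsto_add_atTop_nat (d + 1))
    simpa using h7.const_sub 1
  induction k with
  | zero =>
    refine tendsto_const_nhds.congr fun i => ?_
    rw [add_zero, div_self (hpos i)]
  | succ k ih =>
    have h8 := ih.mul (h1.comp (Filter.tendsto_add_atTop_nat k))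
    rw [mul_one] at h8
    refine h8.congr fun i => ?_
    simp only [Function.comp]
    rw [div_mul_div_cancel₀ (hpos _), add_assoc i k 1]

/-- The zonal polynomials reproduce the eigenfunctions of the Laplace-Beltrami operator. -/
theorem integral_mul_zonalPoly {n : ℕ} (hn : 1 ≤ n) {k : ℕ} {f : CSphere n → ℂ}
    (hf : f ∈ eigenspace n k) (e : CSphere n) :
    ∫ x, f x * (((zonalPoly (n - 1) k).eval (herm x e).re : ℝ) : ℂ) ∂(nu n) = f e := by
  have := isProbabilityMeasure_nu hn
  set I := ∫ x, f x * (((zonalPoly (n - 1) k).eval (herm x e).re : ℝ) : ℂ) ∂(nu n) with hI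
  set a : ℕ → ℝ := fun i => ((dim n + i).choose (dim n) : ℝ) with ha
  have hapos : ∀ i, 0 < a i := fun i => by
    have : 0 < (dim n + i).choose (dim n) := Nat.choose_pos (by omega)
    simp only [ha]
    positivity
  have hS : ∀ m, Continuous fun x : CSphere n => cesaroKernel (n - 1) m (herm x e).re := fun m =>
    (continuous_cesaroKernel _ m).comp (continuous_re_herm e)
  -- With m = i + k, integrate f - f(e) against the nonnegative Cesàro kernel of index m + 1. `K`
  -- depends on ε but not on `i`.
  have hbound : ∀ ε > 0, ∃ K : ℝ, ∀ i : ℕ,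
      ‖(a (i + 1) : ℂ) * I - (a (i + 1 + k) : ℂ) * f e‖ ≤
        ε * a (i + 1 + k) + K * (a (i + 1 + k) - a (i + k)) := by
    intro ε hε
    obtain ⟨K, hK⟩ := exists_norm_sub_le hf.1.continuous e hε
    refine ⟨K, fun i => ?_⟩
    set m := i + k with hm
    have hm1 : i + 1 + k = m + 1 := by omega
    rw [hm1]
    set S : CSphere n → ℝ := fun x => cesaroKernel (n - 1) (m + 1) (herm x e).re with hSdef
    have hSc : Continuous S := hS (m + 1)
    have h1 := integral_mul_cesaroKernel hn (by omega : k ≤ m + 1) hf e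
    rw [← hI, show m + 1 - k = i + 1 by omega] at h1
    have h2 : ∫ x, S x ∂(nu n) = a (m + 1) := integral_cesaroKernel hn (m + 1) e
    have h3 : ∫ x, (herm x e).re * S x ∂(nu n) = a m := integral_re_herm_mul_cesaroKernel hn m e
    have h4 : (a (i + 1) : ℂ) * I - (a (m + 1) : ℂ) * f e =
        ∫ x, (f x - f e) * (S x : ℂ) ∂(nu n) := by
      simp only [sub_mul]
      rw [integral_sub, integral_const_mul, integral_complex_ofReal, h2, h1]
      · simp only [ha]
        push_cast
        ring
      · exact integrable_of_continuous hn
          (hf.1.continuous.mul (Complex.continuous_ofReal.comp hSc))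
      · exact integrable_of_continuous hn
          (continuous_const.mul (Complex.continuous_ofReal.comp hSc))
    have h5 : ∫ x, (ε + K * (1 - (herm x e).re)) * S x ∂(nu n) =
        ε * a (m + 1) + K * (a (m + 1) - a m) := by
      have h6 : ∀ x, (ε + K * (1 - (herm x e).re)) * S x =
          (ε + K) * S x - K * ((herm x e).re * S x) := fun x => by ring
      simp only [h6]
      rw [integral_sub, integral_const_mul, integral_const_mul, h2, h3]
      · ring
      · exact integrable_of_continuous hn (continuous_const.mul hSc)
      · exact integrable_of_continuous hn (continuous_const.mul ((continuous_re_herm e).mul hSc))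
    rw [h4, ← h5]
    refine norm_integral_le_of_norm_le ?_ (Filter.Eventually.of_forall fun x => ?_)
    · have := continuous_re_herm e
      exact integrable_of_continuous hn (by fun_prop)
    · have hS0 : 0 ≤ S x := cesaroKernel_nonneg _ _ (neg_one_le_re_herm x e)
      rw [norm_mul, Complex.norm_real, Real.norm_of_nonneg hS0]
      exact mul_le_mul_of_nonneg_right (hK x) hS0
  -- Divide by the total mass a(m + 1) and let i → ∞: both binomial ratios tend to 1, which removes
  -- the `K` term.
  have hle : ∀ ε > 0, ‖I - f e‖ ≤ ε := by
    intro ε hε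
    obtain ⟨K, hK⟩ := hbound ε hε
    have hr1 : Filter.Tendsto (fun i : ℕ => a (i + 1) / a (i + 1 + k)) Filter.atTop (nhds 1) :=
      (tendsto_choose_div_choose (dim n) k).comp (Filter.tendsto_add_atTop_nat 1)
    have hr2 : Filter.Tendsto (fun i : ℕ => a (i + k) / a (i + 1 + k)) Filter.atTop (nhds 1) := by
      have := (tendsto_choose_div_choose (dim n) 1).comp (Filter.tendsto_add_atTop_nat k)
      refine this.congr fun i => ?_
      simp only [Function.comp, ha]
      rw [add_right_comm i 1 k]
    have hL : Filter.Tendsto (fun i : ℕ => ‖((a (i + 1) / a (i + 1 + k) : ℝ) : ℂ) * I - f e‖)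
        Filter.atTop (nhds ‖I - f e‖) := by
      have := (((Complex.continuous_ofReal.tendsto 1).comp hr1).mul_const I).sub_const (f e)
      simpa using this.norm
    have hR : Filter.Tendsto (fun i : ℕ => ε + K * (1 - a (i + k) / a (i + 1 + k)))
        Filter.atTop (nhds ε) := by
      simpa using ((hr2.const_sub 1).const_mul K).const_add ε
    refine le_of_tendsto_of_tendsto' hL hR fun i => ?_
    have hp := hapos (i + 1 + k)
    have h1 : ((a (i + 1) / a (i + 1 + k) : ℝ) : ℂ) * I - f e =
        ((a (i + 1 + k))⁻¹ : ℝ) • ((a (i + 1) : ℂ) * I - (a (i + 1 + k) : ℂ) * f e) := by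
      have : (a (i + 1 + k) : ℂ) ≠ 0 := by exact_mod_cast hp.ne'
      rw [Complex.real_smul]
      push_cast
      field_simp
    rw [h1, norm_smul, Real.norm_of_nonneg (by positivity), inv_mul_le_iff₀ hp]
    refine (hK i).trans (le_of_eq ?_)
    field_simp
  have h0 : ‖I - f e‖ = 0 := le_antisymm (le_of_forall_pos_le_add fun ε hε => by
    simpa using hle ε hε) (norm_nonneg _)
  exact sub_eq_zero.1 (norm_eq_zero.1 h0)

/-! ### The de la Vallée Poussin kernels -/

/-- The profile of the reproducing kernel of the `k`-th eigenspace. -/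
def reproducingProfile (n k : ℕ) (w : ℂ) : ℂ := (((zonalPoly (n - 1) k).eval w.re : ℝ) : ℂ)

theorem isReproducingKernel_reproducingProfile {n : ℕ} (hn : 1 ≤ n) (k : ℕ) :
    IsReproducingKernel (eigenspace n k) (invKernel (reproducingProfile n k)) := by
  refine ⟨fun y => zonalPoly_mem_eigenspace hn k y, fun f hf y => ?_⟩
  rw [← integral_mul_zonalPoly hn hf y]
  simp [invKernel, reproducingProfile]

theorem vpKernel_mem_polySpace {n : ℕ} (hn : 1 ≤ n) (a N : ℕ) (e : CSphere n) :
    (fun x => invKernel (vpKernel n (reproducingProfile n) a N) x e) ∈ polySpace n a (2 * N) := by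
  have h : (fun x => invKernel (vpKernel n (reproducingProfile n) a N) x e) =
      ∑ k ∈ Finset.Icc a (2 * N), (cutoff (dim n) (dim n) ((k : ℝ) / (2 * (N : ℝ))) : ℂ) •
        fun x => invKernel (reproducingProfile n k) x e := by
    funext x
    simp [invKernel, vpKernel]
  rw [h]
  refine Submodule.sum_mem _ fun k hk => Submodule.smul_mem _ _ ?_
  exact Submodule.mem_iSup_of_mem k (Submodule.mem_iSup_of_mem hk
    (zonalPoly_mem_eigenspace hn k e))

theorem continuous_reproducingProfile (n k : ℕ) : Continuous (reproducingProfile n k) :=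
  Complex.continuous_ofReal.comp ((zonalPoly (n - 1) k).continuous.comp Complex.continuous_re)

theorem continuous_vpKernel (n a N : ℕ) : Continuous (vpKernel n (reproducingProfile n) a N) := by
  have := continuous_reproducingProfile n
  unfold vpKernel
  fun_prop

theorem continuous_herm_right {n : ℕ} (x : CSphere n) :
    Continuous fun y : CSphere n => herm x y := by
  unfold herm
  fun_prop

theorem dim_pos {n : ℕ} (hn : 1 ≤ n) : 0 < dim n := by
  unfold dim
  omega

/-- Orthogonality leaves the k-th term, whose weight is 1 since k ≤ N means k/(2N) ≤ 1/2. -/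
theorem conv_vpKernel_of_mem_eigenspace {n : ℕ} (hn : 1 ≤ n) {a N k : ℕ} (hN : 1 ≤ N)
    (hk : k ∈ Finset.Icc a N) {f : CSphere n → ℂ} (hf : f ∈ eigenspace n k) :
    conv (vpKernel n (reproducingProfile n) a N) f = f := by
  rw [Finset.mem_Icc] at hk
  funext x
  have h1 : ∀ y, f y * invKernel (vpKernel n (reproducingProfile n) a N) x y =
      ∑ j ∈ Finset.Icc a (2 * N), (cutoff (dim n) (dim n) ((j : ℝ) / (2 * (N : ℝ))) : ℂ) *
        (f y * (((zonalPoly (n - 1) j).eval (herm y x).re : ℝ) : ℂ)) := by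
    intro y
    rw [invKernel, vpKernel, Finset.mul_sum]
    refine Finset.sum_congr rfl fun j _ => ?_
    rw [reproducingProfile, re_herm_comm]
    ring
  unfold conv
  simp only [h1]
  rw [integral_finsetSum]
  · simp only [integral_const_mul]
    rw [Finset.sum_eq_single_of_mem k (Finset.mem_Icc.2 ⟨hk.1, by omega⟩),
      integral_mul_zonalPoly hn hf x]
    · have hN' : (1 : ℝ) ≤ N := by exact_mod_cast hN
      have hkN : (k : ℝ) ≤ N := by exact_mod_cast hk.2
      rw [(isSmoothCutoff_cutoff (dim_pos hn)).eq_one, Complex.ofReal_one, one_mul]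
      refine ⟨by positivity, ?_⟩
      rw [div_le_div_iff₀ (by linarith) (by norm_num)]
      linarith
    · intro j _ hj
      rw [integral_mul_eq_zero_of_mem_eigenspace hn hj.symm hf (zonalPoly_mem_eigenspace hn j x),
        mul_zero]
  · intro j _
    exact (integrable_of_continuous hn (hf.1.continuous.mul
      (Complex.continuous_ofReal.comp (continuous_zonal _ x)))).const_mul _

theorem conv_add {n : ℕ} (hn : 1 ≤ n) {Ψ : ℂ → ℂ} (hΨ : Continuous Ψ) {f g : CSphere n → ℂ}
    (hf : Continuous f) (hg : Continuous g) : conv Ψ (f + g) = conv Ψ f + conv Ψ g := by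
  funext x
  have hc : Continuous fun y => invKernel Ψ x y := hΨ.comp (continuous_herm_right x)
  simp only [conv, Pi.add_apply, add_mul]
  exact integral_add (integrable_of_continuous hn (hf.mul hc))
    (integrable_of_continuous hn (hg.mul hc))

theorem conv_smul {n : ℕ} (Ψ : ℂ → ℂ) (c : ℂ) (f : CSphere n → ℂ) :
    conv Ψ (c • f) = c • conv Ψ f := by
  funext x
  simp only [conv, Pi.smul_apply, smul_eq_mul, mul_assoc]
  exact integral_const_mul _ _

theorem conv_vpKernel {n : ℕ} (hn : 1 ≤ n) {a N : ℕ} (hN : 1 ≤ N) {t : CSphere n → ℂ}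
    (ht : t ∈ polySpace n a N) : conv (vpKernel n (reproducingProfile n) a N) t = t := by
  set Ψ := vpKernel n (reproducingProfile n) a N with hΨ
  have hc : Continuous Ψ := continuous_vpKernel n a N
  -- Continuity is part of the condition because additivity of the convolution needs integrability.
  let W : Submodule ℂ (CSphere n → ℂ) :=
    { carrier := {f | Continuous f ∧ conv Ψ f = f}
      zero_mem' := ⟨continuous_const, by funext x; simp [conv]⟩
      add_mem' := fun {f g} hf hg =>
        ⟨hf.1.add hg.1, by rw [conv_add hn hc hf.1 hg.1, hf.2, hg.2]⟩
      smul_mem' := fun c f hf => ⟨hf.1.const_smul c, by rw [conv_smul, hf.2]⟩ }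
  have hle : polySpace n a N ≤ W := iSup₂_le fun k hk f hf =>
    ⟨hf.1.continuous, conv_vpKernel_of_mem_eigenspace hn hN hk hf⟩
  exact (hle ht).2

/-! ### The uniform L₁ bound -/

theorem norm_vpKernel_le {n : ℕ} (hn : 1 ≤ n) {a N : ℕ} (ha : a = 0 ∨ a = 1) (hN : 1 ≤ N)
    {w : ℂ} (hw : -1 ≤ w.re) :
    ‖vpKernel n (reproducingProfile n) a N w‖ ≤ ∑ k ∈ Finset.range (2 * N + 1),
      |(fwdDiff 1)^[dim n + 1]
        (fun k : ℕ => cutoff (dim n) (dim n) ((k : ℝ) / (2 * N))) k| *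
          cesaroKernel (n - 1) k w.re + 1 := by
  have hd := dim_pos hn
  have hd2 : dim n + 1 = 2 * (n - 1) + 2 := by
    unfold dim
    omega
  have hN' : (1 : ℝ) ≤ N := by exact_mod_cast hN
  set g : ℕ → ℝ := fun k => cutoff (dim n) (dim n) ((k : ℝ) / (2 * N)) with hg
  have hg0 : ∀ k, 2 * N + 1 ≤ k → g k = 0 := by
    intro k hk
    refine cutoff_eq_zero hd hd.ne' ?_
    rw [one_le_div (by linarith)]
    have : 2 * N ≤ k := by omega
    exact_mod_cast this
  have hg1 : g 0 = 1 := (isSmoothCutoff_cutoff hd).eq_one _ (by simp)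
  have hsum := sum_mul_coeff_eq_sum_fwdDiff hg0 (zonalSeries (n - 1) w.re) (dim n + 1)
  simp only [zonalSeries, PowerSeries.coeff_mk] at hsum
  have hfull : |∑ k ∈ Finset.range (2 * N + 1), g k * (zonalPoly (n - 1) k).eval w.re| ≤
      ∑ k ∈ Finset.range (2 * N + 1), |(fwdDiff 1)^[dim n + 1] g k| *
        cesaroKernel (n - 1) k w.re := by
    rw [hsum]
    refine (Finset.abs_sum_le_sum_abs _ _).trans (le_of_eq (Finset.sum_congr rfl fun k _ => ?_))
    rw [abs_mul, abs_mul, abs_pow, abs_neg, abs_one, one_pow, one_mul]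
    congr 1
    rw [hd2]
    exact abs_of_nonneg (cesaroKernel_nonneg (n - 1) k hw)
  have hcast : vpKernel n (reproducingProfile n) a N w =
      ((∑ k ∈ Finset.Icc a (2 * N), g k * (zonalPoly (n - 1) k).eval w.re : ℝ) : ℂ) := by
    simp [vpKernel, reproducingProfile, hg]
  rw [hcast, Complex.norm_real, Real.norm_eq_abs]
  have hIcc : Finset.range (2 * N + 1) = Finset.Icc 0 (2 * N) := by
    ext k
    simp
  rcases ha with rfl | rfl
  · rw [← hIcc]
    linarith
  -- For `a = 1` the omitted term is χ_d(0) Z_0 = 1, which accounts for the summand `+ 1` in the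
  -- bound.
  · have h1 : ∑ k ∈ Finset.range (2 * N + 1), g k * (zonalPoly (n - 1) k).eval w.re =
        1 + ∑ k ∈ Finset.Icc 1 (2 * N), g k * (zonalPoly (n - 1) k).eval w.re := by
      rw [hIcc, ← Finset.sum_Ioc_add_eq_sum_Icc (Nat.zero_le _), hg1, zonalPoly_zero, add_comm]
      simp
      rfl
    rw [h1] at hfull
    set s := ∑ k ∈ Finset.Icc 1 (2 * N), g k * (zonalPoly (n - 1) k).eval w.re
    have h2 : |s| ≤ |1 + s| + 1 := by
      have := abs_sub (1 + s) 1
      simpa using this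
    linarith

theorem exists_eLpNorm_vpKernel_le {n : ℕ} (hn : 1 ≤ n) :
    ∃ C : ℝ≥0, ∀ a : ℕ, a = 0 ∨ a = 1 → ∀ N : ℕ, 1 ≤ N → ∀ e : CSphere n,
      eLpNorm (fun x => invKernel (vpKernel n (reproducingProfile n) a N) x e) 1 (nu n) ≤ C := by
  have := isProbabilityMeasure_nu hn
  obtain ⟨C, hC⟩ := exists_sum_abs_fwdDiff_cutoff_le (dim_pos hn).ne'
  refine ⟨C + 1, fun a ha N hN e => ?_⟩
  have hherm : Continuous fun x : CSphere n => herm x e := by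
    unfold herm
    fun_prop
  have hQ : Integrable (fun x => invKernel (vpKernel n (reproducingProfile n) a N) x e) (nu n) :=
    integrable_of_continuous hn ((continuous_vpKernel n a N).comp hherm)
  have hS : ∀ k : ℕ, Integrable (fun x => cesaroKernel (n - 1) k (herm x e).re) (nu n) := fun k =>
    integrable_of_continuous hn ((continuous_cesaroKernel _ k).comp (continuous_re_herm e))
  rw [eLpNorm_one_eq_lintegral_enorm, ← ofReal_integral_norm_eq_lintegral_enorm hQ,
    ← ENNReal.ofReal_coe_nnreal]
  refine ENNReal.ofReal_le_ofReal ?_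
  set D : ℕ → ℝ := fun k => |(fwdDiff 1)^[dim n + 1]
    (fun k : ℕ => cutoff (dim n) (dim n) ((k : ℝ) / (2 * N))) k| with hD
  have h_integrand : Integrable (fun x => ∑ k ∈ Finset.range (2 * N + 1),
      D k * cesaroKernel (n - 1) k (herm x e).re) (nu n) :=
    integrable_finsetSum _ fun k _ => (hS k).const_mul _
  calc ∫ x, ‖invKernel (vpKernel n (reproducingProfile n) a N) x e‖ ∂(nu n)
      ≤ ∫ x, (∑ k ∈ Finset.range (2 * N + 1),
          D k * cesaroKernel (n - 1) k (herm x e).re + 1) ∂(nu n) :=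
        integral_mono hQ.norm (h_integrand.add (integrable_const _)) fun x =>
          norm_vpKernel_le hn ha hN (neg_one_le_re_herm x e)
    _ = ∑ k ∈ Finset.range (2 * N + 1), D k * ((dim n + k).choose (dim n) : ℝ) + 1 := by
        rw [integral_add h_integrand (integrable_const _), integral_finsetSum _ fun k _ =>
          (hS k).const_mul _, integral_const, probReal_univ, one_smul]
        simp only [integral_const_mul, integral_cesaroKernel hn]
    _ ≤ ((C + 1 : ℝ≥0) : ℝ) := by
        push_cast
        linarith [hC N hN]

end ComplexSphere

end

/-- On the unit sphere of `ℂⁿ` (real dimension `d = 2 * n - 1`): the function `χ_d` is a smooth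
piecewise polynomial cutoff, the eigenspaces `H_k` of the Laplace-Beltrami operator have unitarily
invariant reproducing kernels `M_k`, and the kernels `Q_{2N} = ∑ k ∈ [a, 2N], χ_d (k / (2N)) M_k`
belong to `T_{2N} = lin {H_k : a ≤ k ≤ 2N}`, reproduce `T_N` by convolution, and are bounded in
`L₁` uniformly in `N`; here `a = 0` or `a = 1` according to whether constants are
included or not. -/
theorem lemma1 (n : ℕ) (hn : 1 ≤ n) :
    ComplexSphere.IsSmoothCutoff (ComplexSphere.dim n)
      (ComplexSphere.cutoff (ComplexSphere.dim n) (ComplexSphere.dim n)) ∧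
    ∃ M : ℕ → ℂ → ℂ,
      (∀ k, ComplexSphere.IsReproducingKernel (ComplexSphere.eigenspace n k)
        (ComplexSphere.invKernel (M k))) ∧
      ∃ C : ℝ≥0, ∀ a ∈ ({0, 1} : Set ℕ), ∀ N : ℕ, 1 ≤ N →
        (∀ e : ComplexSphere.CSphere n,
          (fun x => ComplexSphere.invKernel (ComplexSphere.vpKernel n M a N) x e) ∈
            ComplexSphere.polySpace n a (2 * N)) ∧
        (∀ t ∈ ComplexSphere.polySpace n a N,
          ComplexSphere.conv (ComplexSphere.vpKernel n M a N) t = t) ∧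
        (∀ e : ComplexSphere.CSphere n,
          eLpNorm (fun x => ComplexSphere.invKernel (ComplexSphere.vpKernel n M a N) x e) 1
            (ComplexSphere.nu n) ≤ C) := by
  obtain ⟨C, hC⟩ := ComplexSphere.exists_eLpNorm_vpKernel_le hn
  refine ⟨ComplexSphere.isSmoothCutoff_cutoff (ComplexSphere.dim_pos hn),
    ComplexSphere.reproducingProfile n, ComplexSphere.isReproducingKernel_reproducingProfile hn,
    C, fun a ha N hN => ⟨ComplexSphere.vpKernel_mem_polySpace hn a N,
      fun t ht => ComplexSphere.conv_vpKernel hn hN ht, hC a (by simpa using ha) N hN⟩⟩
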